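/- For $S\in M_n(\mathbb C)$ let $\overline S$ be the entrywise conjugate. Matrices $A,B\in M_n(\mathbb C)$ are consimilar if $B=SA\overline S^{-1}$ for some nonsingular $S$. Let $J_k(a)$ be the $k\times k$ Jordan block with eigenvalue $a$. A canonical form under consimilarity of a nonsingular matrix $A$ is a matrix consimilar to $A$ which is, up to a simultaneous permutation of rows and columns, a direct sum $$\bigoplus_{i}J_{k_i}(\sqrt{\mu_i})\ \oplus\ \bigoplus_{i}\begin{bmatrix}0&I_{l_i}\\ J_{l_i}(\nu_i)&0\end{bmatrix}\ \oplus\ \bigoplus_{i}\begin{bmatrix}0&I_{m_i}\\ J_{m_i}(c_i)&0\end{bmatrix},\qquad \mu_i>0,\quad \nu_i<0,\quad c_i\in\mathbb C\setminus\mathbb R .$$ Its numbers of positive, negative and nonreal entries are $\sum_i k_i$, $\sum_i l_i$ and $\sum_i m_i$, respectively. Let $\mathcal G_n\subset M_n(\mathbb C)$ be the set of all $B$ for which there is a nonsingular $S$ with $$SB\overline S^{-1}=\begin{bmatrix}D&0\\0&\Lambda\end{bmatrix},$$ where $D$ is a diagonal matrix with pairwise distinct strictly positive diagonal entries and $\Lambda$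 is block diagonal with $2\times2$ blocks $\begin{bmatrix}0&1\\ \lambda_j&0\end{bmatrix}$, where each $\lambda_j$ is nonreal or strictly negative, and $\lambda_i\neq\lambda_j$, $\lambda_i\ne\overline{\lambda_j}$ for $i\neq j$ (either $D$ or $\Lambda$ may be empty). Proposition. Every nonsingular $A\in M_n(\mathbb C)$ has a canonical form under consimilarity, and arbitrarily close to $A$ there is a matrix $\widetilde A\in\mathcal G_n$ such that the numbers of positive, of negative and of nonreal entries in any canonical form of $\widetilde A$ under consimilarity equal those in any canonical form of $A$. Moreover, $\mathcal G_n$ is open and dense in $M_n(\mathbb C)$, so that the condition $\widetilde A\in\mathcal G_n$ is generic. -/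

import Mathlib

open scoped Matrix

/-- The entrywise complex conjugate of a matrix. -/
def conjMatrix {ι : Type*} (A : Matrix ι ι ℂ) : Matrix ι ι ℂ :=
  A.map (starRingEnd ℂ)

/-- `A` and `B` are consimilar: `B = S A S̄⁻¹` for some nonsingular `S`. -/
def Consimilar {ι : Type*} [Fintype ι] [DecidableEq ι] (A B : Matrix ι ι ℂ) : Prop :=
  ∃ S : Matrix ι ι ℂ, IsUnit S.det ∧ S * A * (conjMatrix S)⁻¹ = B

/-- The `k × k` Jordan block with `a` on the diagonal and ones on the superdiagonal. -/
def jordanBlock (k : ℕ) (a : ℂ) : Matrix (Fin k) (Fin k) ℂ :=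
  Matrix.of fun i j => if i = j then a else if (i : ℕ) + 1 = (j : ℕ) then 1 else 0

/-- The `2k × 2k` matrix `[[0, I], [J_k(a), 0]]`. -/
def doubledJordanBlock (k : ℕ) (a : ℂ) : Matrix (Fin k ⊕ Fin k) (Fin k ⊕ Fin k) ℂ :=
  Matrix.fromBlocks 0 1 (jordanBlock k a) 0

/-- The parameters of a canonical form under consimilarity of a nonsingular matrix: the sizes
`k, l, m` and the parameters `μ > 0`, `ν < 0`, `c ∉ ℝ` of its blocks of the three types. -/
structure ConsimilarityData where
  r : ℕ
  s : ℕ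
  u : ℕ
  k : Fin r → ℕ
  l : Fin s → ℕ
  m : Fin u → ℕ
  μ : Fin r → ℝ
  ν : Fin s → ℝ
  c : Fin u → ℂ
  k_pos : ∀ i, 0 < k i
  l_pos : ∀ i, 0 < l i
  m_pos : ∀ i, 0 < m i
  μ_pos : ∀ i, 0 < μ i
  ν_neg : ∀ i, ν i < 0
  c_nonreal : ∀ i, (c i).im ≠ 0

namespace ConsimilarityData

/-- The index set of the rows and columns of the canonical form. -/
abbrev Index (C : ConsimilarityData) : Type :=
  (Σ i : Fin C.r, Fin (C.k i)) ⊕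
    ((Σ i : Fin C.s, Fin (C.l i) ⊕ Fin (C.l i)) ⊕ (Σ i : Fin C.u, Fin (C.m i) ⊕ Fin (C.m i)))

/-- The canonical form: the direct sum of the blocks `J_k(√μ)`, `[[0, I], [J_l(ν), 0]]` and
`[[0, I], [J_m(c), 0]]`. -/
noncomputable def toMatrix (C : ConsimilarityData) : Matrix C.Index C.Index ℂ :=
  Matrix.fromBlocks
    (Matrix.blockDiagonal' fun i => jordanBlock (C.k i) ((Real.sqrt (C.μ i) : ℝ) : ℂ)) 0 0
    (Matrix.fromBlocks
      (Matrix.blockDiagonal' fun i => doubledJordanBlock (C.l i) ((C.ν i : ℝ) : ℂ)) 0 0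
      (Matrix.blockDiagonal' fun i => doubledJordanBlock (C.m i) (C.c i)))

/-- The number of positive entries `√μ` of the canonical form: a block `J_k(√μ)` has `k`. -/
def numPos (C : ConsimilarityData) : ℕ := ∑ i, C.k i

/-- The number of negative entries `ν`: a block `[[0, I], [J_l(ν), 0]]` has `l`. -/
def numNeg (C : ConsimilarityData) : ℕ := ∑ i, C.l i

/-- The number of nonreal entries `c`: a block `[[0, I], [J_m(c), 0]]` has `m`. -/
def numNonreal (C : ConsimilarityData) : ℕ := ∑ i, C.m i

end ConsimilarityData

/-- `C` gives a canonical form of `A` under consimilarity (the bijection `e` only numbers the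
rows and columns). -/
def HasCanonicalForm {n : ℕ} (A : Matrix (Fin n) (Fin n) ℂ) (C : ConsimilarityData) : Prop :=
  ∃ e : C.Index ≃ Fin n, Consimilar A (Matrix.reindex e e C.toMatrix)

/-- The matrix `D ⊕ Λ` with `D = diag(d₁, …, d_p)` and `Λ` block diagonal with the `2 × 2` blocks
`[[0, 1], [lam j, 0]]`, `j = 1, …, q`; rows and columns are in this order. -/
noncomputable def diagSumBlocks {p q : ℕ} (d : Fin p → ℝ) (lam : Fin q → ℂ) :
    Matrix (Fin (p + q * 2)) (Fin (p + q * 2)) ℂ :=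
  Matrix.reindex finSumFinEquiv finSumFinEquiv
    (Matrix.fromBlocks (Matrix.diagonal fun i => ((d i : ℝ) : ℂ)) 0 0
      (Matrix.reindex finProdFinEquiv finProdFinEquiv
        (Matrix.of fun a b : Fin q × Fin 2 =>
          if a.1 = b.1 then (!![0, 1; lam a.1, 0] : Matrix (Fin 2) (Fin 2) ℂ) a.2 b.2 else 0)))

/-- `B` is consimilar to some `D ⊕ Λ` where `D` has distinct positive diagonal entries, and
`Λ` has blocks `[[0, 1], [lam j, 0]]` with each `lam j` negative or nonreal, and the `lam j`
are pairwise distinct, even up to complex conjugation. -/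
def HasDistinctDiagSumForm {n : ℕ} (B : Matrix (Fin n) (Fin n) ℂ) : Prop :=
  ∃ (p q : ℕ) (h : p + q * 2 = n) (d : Fin p → ℝ) (lam : Fin q → ℂ),
    (∀ i, 0 < d i) ∧
    (∀ j, (lam j).im ≠ 0 ∨ ((lam j).im = 0 ∧ (lam j).re < 0)) ∧
    Function.Injective d ∧
    (∀ i j, i ≠ j → lam i ≠ lam j ∧ lam i ≠ (starRingEnd ℂ) (lam j)) ∧
    Consimilar B (Matrix.reindex (finCongr h) (finCongr h) (diagSumBlocks d lam))

/-! A matrix $A$ is the antilinear map $T : v \mapsto A\bar v$ on $\mathbb C^n$, and consimilarity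
is change of basis for $T$. The square $T^2 = A\bar A$ is linear, so its spectrum with
multiplicities is a consimilarity invariant, and everything is read off from it.

Existence of the form: induct on dimension. Take an eigenvalue $c$ of $T^2$ and a longest chain for
it. The chain is paired with a family of functionals, stable under the dual of $T$, built from one
functional that detects the end of the chain; the pairing is triangular, so the common kernel of the
functionals is a $T$-invariant complement (`span_sup_ker_of_triangular`). For $c$ negative or
nonreal the chain is doubled by its image under $T$ (`exists_chain_of_not_pos`). For $c = \mu > 0$
the factorisation $T^2-\mu = (T-\sqrt\mu)(T+\sqrt\mu)$ over $\mathbb R$ gives a chain of $T$ itself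
(`exists_chain_of_pos`).

Invariance of the three numbers: a block with $\mu$ contributes $\mu$ to the spectrum of $A\bar A$
as often as its size, and a doubled block with $\lambda$ contributes both $\lambda$ and
$\bar\lambda$. Counting positive, negative and nonreal eigenvalues therefore gives the number of
positive entries and twice the other two (`HasCanonicalForm.countP_eq`). The same computation shows
that $\mathcal G_n$ is described by the spectrum alone: nonzero eigenvalues, all simple except that
negative ones may be double (`hasDistinctDiagSumForm_iff`).

Approximation and density: real shifts of the diagonal parameters, distinct at distinct places,
separate them without changing their type; nonsingular matrices are themselves dense.

Openness: the characteristic polynomial $p$ of $B\bar B$ is real with coefficients continuous in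
$B$. Failure of genericity is the existence of a root $z$ that is zero, or is multiple and either
nonnegative or a zero of the divided difference of $p'$ at $(z,\bar z)$. That quantity is $p''(z)$
for real $z$ and vanishes automatically at a nonreal multiple root, so one closed condition covers
both cases (`isGenericSpectrum_roots_iff`). Roots are bounded by the entries, so eliminating $z$
preserves closedness (`isClosed_exists_of_bound`). -/

section

open Module

/-! ### Complements from triangular pairings. -/

section Triangular

variable {V ι : Type} [AddCommGroup V] [Module ℂ V] [FiniteDimensional ℂ V] [Fintype ι]

/-- A family of vectors and a family of functionals whose pairing is triangular with nonzero
diagonal: the vectors span a complement of the common kernel of the functionals. -/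
theorem span_sup_ker_of_triangular (a : ι → V) (φ : ι → V →ₗ[ℂ] ℂ) (h : ι → ℕ)
    (hne : ∀ i, φ i (a i) ≠ 0) (hz : ∀ i j, i ≠ j → h i ≤ h j → φ i (a j) = 0) :
    Submodule.span ℂ (Set.range a) ⊔ LinearMap.ker (LinearMap.pi φ) = ⊤ ∧
      finrank ℂ (LinearMap.ker (LinearMap.pi φ)) + Fintype.card ι = finrank ℂ V := by
  classical
  set Φ : V →ₗ[ℂ] (ι → ℂ) := LinearMap.pi φ
  set Ψ : (ι → ℂ) →ₗ[ℂ] V := Fintype.linearCombination ℂ a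
  have hΨ : ∀ c, Ψ c = ∑ j, c j • a j := fun c => Fintype.linearCombination_apply ℂ a c
  have hinj : Function.Injective (Φ ∘ₗ Ψ) := by
    rw [← LinearMap.ker_eq_bot, LinearMap.ker_eq_bot']
    intro c hc
    -- Induction on the height: in equation `i` the unknowns of smaller height are already zero, and
    -- the others, except `c i`, have coefficient zero.
    have key : ∀ n, ∀ i, h i = n → c i = 0 := by
      intro n
      induction n using Nat.strong_induction_on with
      | _ n ih =>
        intro i hi
        have h1 : φ i (Ψ c) = 0 := congrFun hc i
        rw [hΨ, map_sum, Finset.sum_eq_single i] at h1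
        · simpa [hne i] using h1
        · intro j _ hj
          rcases lt_or_ge (h j) (h i) with hlt | hge
          · rw [ih (h j) (hi ▸ hlt) j rfl]; simp
          · simp [hz i j (Ne.symm hj) hge]
        · simp
    funext i
    exact key _ i rfl
  have hsurj : Function.Surjective (Φ ∘ₗ Ψ) := LinearMap.injective_iff_surjective.mp hinj
  have hΦ : Function.Surjective Φ := fun y => by
    obtain ⟨c, hc⟩ := hsurj y
    exact ⟨Ψ c, hc⟩
  constructor
  · rw [eq_top_iff]
    intro x _
    obtain ⟨c, hc⟩ := hsurj (Φ x)
    have hx : x = Ψ c + (x - Ψ c) := by abel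
    rw [hx]
    refine Submodule.add_mem_sup ?_ ?_
    · rw [hΨ]
      exact Submodule.sum_mem _ fun j _ => Submodule.smul_mem _ _ (Submodule.subset_span ⟨j, rfl⟩)
    · rw [LinearMap.mem_ker, map_sub, ← hc]; simp
  · have := LinearMap.finrank_range_add_finrank_ker Φ
    rw [LinearMap.range_eq_top.mpr hΦ, finrank_top, finrank_fintype_fun_eq_card] at this
    omega

end Triangular

/-! ### Antilinear maps: chains for negative or nonreal eigenvalues of the square. -/

section Antilinear

variable {V : Type} [AddCommGroup V] [Module ℂ V] (T : V →ₛₗ[starRingEnd ℂ] V)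

/-- The square of an antilinear map, which is linear. -/
def antilinearSq : End ℂ V := T.comp T

theorem antilinearSq_apply (x : V) : antilinearSq T x = T (T x) := rfl

/-- An antilinear map carries `T² - c` to `T² - c̄`. -/
theorem antilinear_pow_sub (c : ℂ) (j : ℕ) (x : V) :
    T (((antilinearSq T - algebraMap ℂ (End ℂ V) c) ^ j) x) =
      ((antilinearSq T - algebraMap ℂ (End ℂ V) (starRingEnd ℂ c)) ^ j) (T x) := by
  induction j generalizing x with
  | zero => simp
  | succ j ih =>
    rw [pow_succ, Module.End.mul_apply, ih, pow_succ, Module.End.mul_apply]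
    simp [antilinearSq_apply, Module.algebraMap_end_apply]

/-- The functional `x ↦ conj (f (T x))`. -/
def antilinearDual (f : V →ₗ[ℂ] ℂ) : V →ₗ[ℂ] ℂ where
  toFun x := starRingEnd ℂ (f (T x))
  map_add' := by simp
  map_smul' := by simp

theorem antilinearDual_apply (f : V →ₗ[ℂ] ℂ) (x : V) :
    antilinearDual T f x = starRingEnd ℂ (f (T x)) := rfl

/-- The exponent `k + 1` is the first at which the kernels of the powers of `N` stabilise. It is
positive because `N` has a nonzero kernel, and minimality supplies `v`, the top of a longest chain.
-/
theorem exists_index {K : Type} [Field K] {V : Type} [AddCommGroup V] [Module K V]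
    [FiniteDimensional K V] (N : End K V) (hN : ∃ x, x ≠ 0 ∧ N x = 0) :
    ∃ k, (∀ u, (N ^ (k + 2)) u = 0 → (N ^ (k + 1)) u = 0) ∧
      ∃ v, (N ^ (k + 1)) v = 0 ∧ (N ^ k) v ≠ 0 := by
  classical
  have hex : ∃ k, ∀ u, (N ^ (k + 1)) u = 0 → (N ^ k) u = 0 := by
    refine ⟨finrank K V, fun u hu => ?_⟩
    have h1 : u ∈ LinearMap.ker (N ^ (finrank K V + 1)) := hu
    exact LinearMap.mem_ker.mp
      ((Module.End.ker_pow_le_ker_pow_finrank N _) h1)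
  have hpos : Nat.find hex ≠ 0 := by
    intro h0
    have := Nat.find_spec hex
    rw [h0] at this
    obtain ⟨x, hx, hx'⟩ := hN
    exact hx (by simpa using this x (by simpa using hx'))
  obtain ⟨k, hk⟩ := Nat.exists_eq_succ_of_ne_zero hpos
  refine ⟨k, ?_, ?_⟩
  · have := Nat.find_spec hex
    rw [hk] at this
    exact this
  · have := Nat.find_min hex (m := k) (by omega)
    push Not at this
    exact this

/-- The generalized eigenspace of `T²` for `c̄ ≠ c` is in the range of `(T² - c)ᵏ`. -/
theorem mem_range_pow_of_ne (L : End ℂ V) {c d : ℂ} (h : c ≠ d) (k : ℕ) (x : V)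
    (hx : ((L - algebraMap ℂ (End ℂ V) d) ^ k) x = 0) :
    ∃ w, ((L - algebraMap ℂ (End ℂ V) c) ^ k) w = x := by
  have hc : IsCoprime ((Polynomial.X - Polynomial.C c) ^ k) ((Polynomial.X - Polynomial.C d) ^ k) :=
    (Polynomial.isCoprime_X_sub_C_of_isUnit_sub (sub_ne_zero.mpr h).isUnit).pow
  obtain ⟨p, q, hpq⟩ := hc
  have h1 := congrArg (Polynomial.aeval L) hpq
  simp only [map_add, map_mul, map_pow, map_sub, Polynomial.aeval_X, Polynomial.aeval_C,
    map_one] at h1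
  -- In the Bézout identity $p(X-c)^k + q(X-d)^k = 1$ evaluated at `L`, the second term kills `x`.
  refine ⟨Polynomial.aeval L p x, ?_⟩
  have h2 := LinearMap.congr_fun h1 x
  rw [LinearMap.add_apply, Module.End.mul_apply, Module.End.mul_apply, hx, map_zero, add_zero,
    Module.End.one_apply] at h2
  have hcomm : Commute ((L - algebraMap ℂ (End ℂ V) c) ^ k) (Polynomial.aeval L p) := by
    have : (L - algebraMap ℂ (End ℂ V) c) ^ k =
        Polynomial.aeval L ((Polynomial.X - Polynomial.C c) ^ k) := by simp
    rw [this]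
    rw [commute_iff_eq, ← map_mul, mul_comm, map_mul]
  rw [← Module.End.mul_apply, hcomm.eq, Module.End.mul_apply, h2]

end Antilinear

section Antilinear

variable {V : Type} [AddCommGroup V] [Module ℂ V] [FiniteDimensional ℂ V]
  (T : V →ₛₗ[starRingEnd ℂ] V)

/-- A functional that vanishes on the range of `(T² - c)ᵏ⁺¹` and on `T v'` but not on `v'`, where
`v' = (T² - c)ᵏ v` is the eigenvector at the end of a longest chain. -/
theorem exists_functional_of_not_pos {c : ℂ} (hc : c.im ≠ 0 ∨ (c.im = 0 ∧ c.re < 0)) {k : ℕ} {v : V}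
    (hk : ∀ u, ((antilinearSq T - algebraMap ℂ (End ℂ V) c) ^ (k + 2)) u = 0 →
      ((antilinearSq T - algebraMap ℂ (End ℂ V) c) ^ (k + 1)) u = 0)
    (hv : ((antilinearSq T - algebraMap ℂ (End ℂ V) c) ^ (k + 1)) v = 0)
    (hv' : ((antilinearSq T - algebraMap ℂ (End ℂ V) c) ^ k) v ≠ 0) :
    ∃ f : V →ₗ[ℂ] ℂ, (∀ u, f (((antilinearSq T - algebraMap ℂ (End ℂ V) c) ^ (k + 1)) u) = 0) ∧
      f (((antilinearSq T - algebraMap ℂ (End ℂ V) c) ^ k) v) ≠ 0 ∧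
      ∀ i j, k ≤ i + j → f (((antilinearSq T - algebraMap ℂ (End ℂ V) c) ^ j)
        (T (((antilinearSq T - algebraMap ℂ (End ℂ V) c) ^ i) v))) = 0 := by
  set N := antilinearSq T - algebraMap ℂ (End ℂ V) c with hN
  set Nb := antilinearSq T - algebraMap ℂ (End ℂ V) (starRingEnd ℂ c) with hNb
  have hTN : ∀ j x, T ((N ^ j) x) = (Nb ^ j) (T x) := antilinear_pow_sub T c
  set v' := (N ^ k) v with hvdef
  have hNv' : N v' = 0 := by
    rw [hvdef, ← Module.End.mul_apply, ← pow_succ']; exact hv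
  have hnot : ∀ u, (N ^ (k + 1)) u ≠ v' := by
    intro u hu
    have h1 : (N ^ (k + 2)) u = 0 := by
      rw [pow_succ', Module.End.mul_apply, hu, hNv']
    exact hv' (by rw [← hu, hk u h1])
  by_cases him : c.im = 0
  · have hre : c.re < 0 := by
      rcases hc with h | h
      · exact absurd him h
      · exact h.2
    have hcc : starRingEnd ℂ c = c := Complex.conj_eq_iff_im.mpr him
    have hNN : Nb = N := by rw [hNb, hcc]
    -- For real `c`, `T v'` is also an eigenvector. If $v' = N^{k+1}u + bTv'$, then $N^{k+2}u = 0$,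
    -- so the first term vanishes by stability of the kernels. Applying `T` to $v' = bTv'$ gives
    -- $|b|^2c = 1$, impossible for $c<0$.
    have hmem : v' ∉ LinearMap.range (N ^ (k + 1)) ⊔ Submodule.span ℂ {T v'} := by
      intro hm
      obtain ⟨y, ⟨u, rfl⟩, z, hz, hyz⟩ := Submodule.mem_sup.mp hm
      obtain ⟨b, rfl⟩ := Submodule.mem_span_singleton.mp hz
      have hNT : N (T v') = 0 := by
        have := hTN 1 v'
        rw [pow_one, pow_one, hNv', map_zero, hNN] at this
        exact this.symm
      have h1 : (N ^ (k + 2)) u = 0 := by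
        have := congrArg N hyz
        rw [map_add, map_smul, hNT, smul_zero, add_zero, hNv'] at this
        rw [pow_succ', Module.End.mul_apply]; exact this
      rw [hk u h1, zero_add] at hyz
      have hL : T (T v') = c • v' := by
        have : antilinearSq T v' - c • v' = 0 := hNv'
        rw [antilinearSq_apply] at this
        exact sub_eq_zero.mp this
      have h2 : (b * starRingEnd ℂ b * c) • v' = v' := by
        have h3 := congrArg T hyz
        rw [LinearMap.map_smulₛₗ, hL] at h3
        rw [mul_assoc, mul_smul, mul_smul, h3, hyz]
      have h3 : b * starRingEnd ℂ b * c = 1 := by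
        by_contra hne
        have : (b * starRingEnd ℂ b * c - 1) • v' = 0 := by rw [sub_smul, h2, one_smul, sub_self]
        rcases smul_eq_zero.mp this with h | h
        · exact hne (sub_eq_zero.mp h)
        · exact hv' h
      rw [Complex.mul_conj] at h3
      have h4 := congrArg Complex.re h3
      rw [Complex.re_ofReal_mul, Complex.one_re] at h4
      nlinarith [Complex.normSq_nonneg b]
    obtain ⟨f, hf, hf'⟩ := Submodule.exists_dual_map_eq_bot_of_notMem hmem inferInstance
    have hker : ∀ y ∈ LinearMap.range (N ^ (k + 1)) ⊔ Submodule.span ℂ {T v'}, f y = 0 := by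
      intro y hy
      have : f y ∈ Submodule.map f (LinearMap.range (N ^ (k + 1)) ⊔ Submodule.span ℂ {T v'}) :=
        Submodule.mem_map_of_mem hy
      rw [hf'] at this
      exact this
    refine ⟨f, fun u => hker _ (Submodule.mem_sup_left ⟨u, rfl⟩), hf, fun i j hij => ?_⟩
    rw [hTN, hNN, ← Module.End.mul_apply, ← pow_add]
    rcases Nat.eq_or_lt_of_le hij with h | h
    · rw [show j + i = k by omega, ← hNN, ← hTN]
      exact hker _ (Submodule.mem_sup_right (Submodule.mem_span_singleton_self _))
    · obtain ⟨d, hd⟩ := Nat.exists_eq_add_of_le h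
      rw [show j + i = (k + 1) + d by omega, pow_add, Module.End.mul_apply]
      exact hker _ (Submodule.mem_sup_left ⟨_, rfl⟩)
  · have hne : c ≠ starRingEnd ℂ c := fun h => him (Complex.conj_eq_iff_im.mp h.symm)
    have hmem : v' ∉ LinearMap.range (N ^ (k + 1)) := fun ⟨u, hu⟩ => hnot u hu
    obtain ⟨f, hf, hf'⟩ := Submodule.exists_dual_map_eq_bot_of_notMem hmem inferInstance
    have hker : ∀ u, f ((N ^ (k + 1)) u) = 0 := by
      intro y
      have : f ((N ^ (k + 1)) y) ∈ Submodule.map f (LinearMap.range (N ^ (k + 1))) :=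
        Submodule.mem_map_of_mem ⟨y, rfl⟩
      rw [hf'] at this
      exact this
    refine ⟨f, hker, hf, fun i j _ => ?_⟩
    -- For nonreal `c`, `T v` lies in the generalized eigenspace for $\bar c \ne c$, hence in the
    -- range of $N^{k+1}$, which `f` annihilates.
    obtain ⟨w, hw⟩ := mem_range_pow_of_ne (antilinearSq T) hne (k + 1) (T v)
      (by rw [← hNb, ← hTN, hv, map_zero])
    rw [← hN] at hw
    have hcomm : Commute Nb N := by
      rw [hNb, hN]
      exact ((Commute.refl _).sub_left (Algebra.commute_algebraMap_left _ _)).sub_right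
        (Algebra.commute_algebraMap_right _ _)
    rw [hTN, ← hw, ← Module.End.mul_apply, ← Module.End.mul_apply, mul_assoc,
      ((hcomm.pow_left i).pow_right (k + 1)).eq, ← mul_assoc,
      ((Commute.refl N).pow_pow j (k + 1)).eq, mul_assoc, Module.End.mul_apply]
    exact hker _

/-- Splitting off a longest chain of `T²` for an eigenvalue that is negative or nonreal. -/
theorem exists_chain_of_not_pos {c : ℂ} (hc : c.im ≠ 0 ∨ (c.im = 0 ∧ c.re < 0))
    (hex : ∃ x, x ≠ 0 ∧ T (T x) = c • x) :
    ∃ (W : Submodule ℂ V) (k : ℕ) (x : ℕ → V), 0 < k ∧ (∀ w ∈ W, T w ∈ W) ∧ x 0 = 0 ∧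
      (∀ j < k, T (T (x (j + 1))) = c • x (j + 1) + x j) ∧
      Submodule.span ℂ (Set.range (Sum.elim (fun j : Fin k => T (x (j + 1)))
        (fun j : Fin k => x (j + 1)))) ⊔ W = ⊤ ∧
      finrank ℂ W + (k + k) = finrank ℂ V := by
  have hc0 : c ≠ 0 := by
    rintro rfl
    simp at hc
  set N := antilinearSq T - algebraMap ℂ (End ℂ V) c with hN
  have hNapp : ∀ x, N x = T (T x) - c • x := fun x => rfl
  obtain ⟨k, hk, v, hv, hv'⟩ := exists_index N (by
    obtain ⟨x, hx, hx'⟩ := hex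
    exact ⟨x, hx, by rw [hNapp, hx', sub_self]⟩)
  obtain ⟨f, hf, hfv, hfT⟩ := exists_functional_of_not_pos T hc hk hv hv'
  rw [← hN] at hf hfv hfT
  have hfbig : ∀ i u, k < i → f ((N ^ i) u) = 0 := by
    intro i u hi
    obtain ⟨d, rfl⟩ := Nat.exists_eq_add_of_le hi
    rw [show k.succ + d = (k + 1) + d from rfl, pow_add, Module.End.mul_apply]
    exact hf _
  have hsucc : ∀ i x, N ((N ^ i) x) = (N ^ (i + 1)) x := fun i x => by
    rw [pow_succ', Module.End.mul_apply]
  have hsq : ∀ j x, (N ^ j) (T (T x)) = c • (N ^ j) x + (N ^ (j + 1)) x := fun j x => by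
    rw [show T (T x) = c • x + N x by rw [hNapp]; abel, map_add, map_smul, pow_succ,
      Module.End.mul_apply]
  -- The chain is numbered from its eigenvector `x 1` upwards, so that `x 0` is $N^{k+1}v = 0$.
  set x : ℕ → V := fun j => (N ^ (k + 1 - j)) v with hx
  let a : Fin (k + 1) ⊕ Fin (k + 1) → V :=
    Sum.elim (fun j => T (x (j + 1))) (fun j => x (j + 1))
  let φ : Fin (k + 1) ⊕ Fin (k + 1) → V →ₗ[ℂ] ℂ :=
    Sum.elim (fun j => antilinearDual T (f ∘ₗ (N ^ (j : ℕ)))) (fun j => f ∘ₗ (N ^ (j : ℕ)))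
  have hmem : ∀ w, w ∈ LinearMap.ker (LinearMap.pi φ) ↔
      ∀ j < k + 1, f ((N ^ j) w) = 0 ∧ f ((N ^ j) (T w)) = 0 := by
    intro w
    rw [LinearMap.mem_ker, funext_iff]
    constructor
    · intro h j hj
      refine ⟨h (Sum.inr ⟨j, hj⟩), ?_⟩
      have := h (Sum.inl ⟨j, hj⟩)
      exact (map_eq_zero (starRingEnd ℂ)).mp this
    · rintro h (⟨j, hj⟩ | ⟨j, hj⟩)
      · exact (map_eq_zero (starRingEnd ℂ)).mpr (h j hj).2
      · exact (h j hj).1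
  -- Functional `j` detects only $N^{k-j}v$ among chain vectors not above it, so heights decrease
  -- with `j`. The mixed pairings of the chain with its image under `T` vanish in this range, even
  -- on the diagonal, by `hfT`.
  have htri := span_sup_ker_of_triangular a φ
    (Sum.elim (fun j => k - (j : ℕ)) (fun j => k - (j : ℕ))) ?_ ?_
  · refine ⟨LinearMap.ker (LinearMap.pi φ), k + 1, x, Nat.succ_pos k, ?_, ?_, ?_, htri.1, ?_⟩
    · intro w hw
      rw [hmem] at hw ⊢
      intro j hj
      refine ⟨(hw j hj).2, ?_⟩
      -- Invariance of the kernel: $T^2 = c + N$ turns the condition on `T w` into the conditions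
      -- for `j` and `j + 1` on `w`, and `f` kills $N^{k+1}$.
      rw [hsq, map_add, map_smul, (hw j hj).1, smul_zero, zero_add]
      rcases Nat.lt_or_ge (j + 1) (k + 1) with h | h
      · exact (hw (j + 1) h).1
      · exact hfbig _ _ h
    · exact hv
    · intro j hj
      have h1 : N (x (j + 1)) = x j := by
        simp only [hx, hsucc]
        rw [show k + 1 - (j + 1) + 1 = k + 1 - j by omega]
      rw [← h1, hNapp]; abel
    · rw [← htri.2]; simp
  · rintro (⟨j, hj⟩ | ⟨j, hj⟩)
    · refine (map_ne_zero (starRingEnd ℂ)).mpr ?_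
      change f ((N ^ j) (T (T ((N ^ (k + 1 - (j + 1))) v)))) ≠ 0
      rw [hsq, map_add, map_smul, ← Module.End.mul_apply, ← Module.End.mul_apply, ← pow_add,
        ← pow_add, show j + (k + 1 - (j + 1)) = k by omega,
        hfbig (j + 1 + (k + 1 - (j + 1))) _ (by omega), add_zero]
      exact smul_ne_zero hc0 hfv
    · change f ((N ^ j) ((N ^ (k + 1 - (j + 1))) v)) ≠ 0
      rw [← Module.End.mul_apply, ← pow_add, show j + (k + 1 - (j + 1)) = k by omega]
      exact hfv
  · rintro (⟨i, hi⟩ | ⟨i, hi⟩) (⟨j, hj⟩ | ⟨j, hj⟩) hne hle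
    · have hij : j ≠ i := fun h => hne (by simp [h])
      change k - i ≤ k - j at hle
      refine (map_eq_zero (starRingEnd ℂ)).mpr ?_
      change f ((N ^ i) (T (T ((N ^ (k + 1 - (j + 1))) v)))) = 0
      rw [hsq, map_add, map_smul, ← Module.End.mul_apply, ← Module.End.mul_apply, ← pow_add,
        ← pow_add, hfbig _ _ (by omega), hfbig _ _ (by omega), smul_zero, add_zero]
    · change k - i ≤ k - j at hle
      refine (map_eq_zero (starRingEnd ℂ)).mpr ?_
      exact hfT (k + 1 - (j + 1)) i (by omega)
    · change k - i ≤ k - j at hle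
      exact hfT (k + 1 - (j + 1)) i (by omega)
    · have hij : j ≠ i := fun h => hne (by simp [h])
      change k - i ≤ k - j at hle
      change f ((N ^ i) ((N ^ (k + 1 - (j + 1))) v)) = 0
      rw [← Module.End.mul_apply, ← pow_add, hfbig _ _ (by omega)]

end Antilinear

/-! ### Chains for positive eigenvalues of the square. -/

section Antilinear

variable {V : Type} [AddCommGroup V] [Module ℂ V] (T : V →ₛₗ[starRingEnd ℂ] V)

/-- An antilinear map, as a real-linear map. -/
def antilinearReal : End ℝ V where
  toFun := T
  map_add' := T.map_add
  map_smul' r x := by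
    rw [← Complex.coe_smul, T.map_smulₛₗ, Complex.conj_ofReal, Complex.coe_smul]
    rfl

/-- The map `f ↦ conj ∘ f ∘ T` on functionals, as a real-linear map. -/
def antilinearDualReal : End ℝ (V →ₗ[ℂ] ℂ) where
  toFun := antilinearDual T
  map_add' f g := by ext x; simp [antilinearDual_apply]
  map_smul' r f := by ext x; simp [antilinearDual_apply]

theorem sub_algebraMap_pow_apply {K U : Type} [CommRing K] [AddCommGroup U] [Module K U]
    (S : End K U) (s : K) (j : ℕ) (x : U) :
    S (((S - algebraMap K (End K U) s) ^ j) x) =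
      s • ((S - algebraMap K (End K U) s) ^ j) x +
        ((S - algebraMap K (End K U) s) ^ (j + 1)) x := by
  rw [pow_succ' _ j, Module.End.mul_apply, LinearMap.sub_apply, Module.algebraMap_end_apply]
  abel

theorem mul_pow_add_sub {K U : Type} [CommRing K] [AddCommGroup U] [Module K U]
    (S : End K U) (s : K) (j : ℕ) :
    (S * S - algebraMap K (End K U) (s * s)) ^ j =
      (S - algebraMap K (End K U) s) ^ j * (S + algebraMap K (End K U) s) ^ j := by
  have h := Algebra.commutes s S
  have hc : Commute (S - algebraMap K (End K U) s) (S + algebraMap K (End K U) s) := by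
    rw [commute_iff_eq, sub_mul, mul_add, mul_add, add_mul, mul_sub, mul_sub, h]
    abel
  rw [← hc.mul_pow, sub_mul, mul_add, mul_add, h, map_mul]
  congr 1
  abel

/-- The square of the antilinear map over `ℂ` and over `ℝ`. -/
theorem antilinearSq_sub_pow_apply (μ : ℝ) (j : ℕ) (x : V) :
    ((antilinearSq T - algebraMap ℂ (End ℂ V) μ) ^ j) x =
      ((antilinearReal T * antilinearReal T - algebraMap ℝ (End ℝ V) μ) ^ j) x := by
  induction j with
  | zero => simp
  | succ j ih =>
    rw [pow_succ', Module.End.mul_apply, ih, pow_succ', Module.End.mul_apply]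
    simp [Module.algebraMap_end_apply, antilinearSq_apply, antilinearReal]

theorem antilinearDualReal_sq_sub_pow_apply (μ : ℝ) (j : ℕ) (f : V →ₗ[ℂ] ℂ) (x : V) :
    ((antilinearDualReal T * antilinearDualReal T - algebraMap ℝ (End ℝ (V →ₗ[ℂ] ℂ)) μ) ^ j) f x =
      f (((antilinearSq T - algebraMap ℂ (End ℂ V) μ) ^ j) x) := by
  induction j generalizing x with
  | zero => simp
  | succ j ih =>
    rw [pow_succ', Module.End.mul_apply, pow_succ (antilinearSq T - _), Module.End.mul_apply, ← ih]
    simp [Module.algebraMap_end_apply, antilinearSq_apply, antilinearDualReal,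
      antilinearDual_apply]

/-- With $T^*f = \overline{f\circ T}$, the terms in `T x` cancel in $\mathrm{Im}\,((T^*-s)f)(x) +
\mathrm{Im}\,f((T-s)x) = -2s\,\mathrm{Im}\,f(x)$. Both terms on the left vanish by induction on the
total nilpotency exponent. -/
theorem im_apply_eq_zero {s : ℝ} (hs : s ≠ 0) (n : ℕ) : ∀ (a b : ℕ) (f : V →ₗ[ℂ] ℂ) (x : V),
    a + b = n → ((antilinearDualReal T - algebraMap ℝ (End ℝ (V →ₗ[ℂ] ℂ)) s) ^ a) f = 0 →
      ((antilinearReal T - algebraMap ℝ (End ℝ V) s) ^ b) x = 0 → (f x).im = 0 := by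
  induction n with
  | zero =>
    intro a b f x hab hf _
    obtain rfl : a = 0 := by omega
    have : f = 0 := hf
    simp [this]
  | succ n ih =>
    intro a b f x hab hf hx
    rcases Nat.eq_zero_or_pos a with rfl | ha
    · have : f = 0 := hf
      simp [this]
    rcases Nat.eq_zero_or_pos b with rfl | hb
    · have : x = 0 := hx
      simp [this]
    obtain ⟨a, rfl⟩ := Nat.exists_eq_succ_of_ne_zero ha.ne'
    obtain ⟨b, rfl⟩ := Nat.exists_eq_succ_of_ne_zero hb.ne'
    have h1 := ih a (b + 1) ((antilinearDualReal T - algebraMap ℝ (End ℝ (V →ₗ[ℂ] ℂ)) s) f) x (by omega)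
      (by rwa [← Module.End.mul_apply, ← pow_succ]) hx
    have h2 := ih (a + 1) b f ((antilinearReal T - algebraMap ℝ (End ℝ V) s) x) (by omega) hf
      (by rwa [← Module.End.mul_apply, ← pow_succ])
    simp [Module.algebraMap_end_apply, antilinearDualReal, antilinearReal,
      antilinearDual_apply] at h1 h2
    have : s * (f x).im = 0 := by linarith
    exact (mul_eq_zero.mp this).resolve_left hs

/-- Conjugation does not affect real parts, so there the dual map is a genuine transpose. Together
with `im_apply_eq_zero` this moves powers of $T^*-s$ across the pairing. -/
theorem re_pow_apply {s : ℝ} (j : ℕ) : ∀ (f : V →ₗ[ℂ] ℂ) (x : V),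
    (((antilinearDualReal T - algebraMap ℝ (End ℝ (V →ₗ[ℂ] ℂ)) s) ^ j) f x).re =
      (f (((antilinearReal T - algebraMap ℝ (End ℝ V) s) ^ j) x)).re := by
  induction j with
  | zero => simp
  | succ j ih =>
    intro f x
    rw [pow_succ, Module.End.mul_apply, ih, pow_succ', Module.End.mul_apply]
    simp [Module.algebraMap_end_apply, antilinearDualReal, antilinearReal,
      antilinearDual_apply]

/-- On an eigenvector for the real number `s`, one application of $T^*+s$ sends a real value $r$ to
$s\bar r + sr = 2sr$. -/
theorem add_pow_apply_of_eigenvector {s : ℝ} {x : V} (hx : T x = s • x) {f : V →ₗ[ℂ] ℂ}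
    (hf : f x = 1) (j : ℕ) :
    ((antilinearDualReal T + algebraMap ℝ (End ℝ (V →ₗ[ℂ] ℂ)) s) ^ j) f x = ((2 * s) ^ j : ℝ) := by
  induction j with
  | zero => simp [hf]
  | succ j ih =>
    rw [pow_succ', Module.End.mul_apply, LinearMap.add_apply, LinearMap.add_apply,
      Module.algebraMap_end_apply, LinearMap.smul_apply, ih]
    change starRingEnd ℂ ((((antilinearDualReal T + algebraMap ℝ (End ℝ (V →ₗ[ℂ] ℂ)) s) ^ j) f) (T x)) + _ = _
    rw [hx, ← Complex.coe_smul, map_smul, ih, smul_eq_mul, ← Complex.ofReal_mul,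
      Complex.conj_ofReal, Complex.real_smul, ← Complex.ofReal_mul, ← Complex.ofReal_add]
    congr 1
    ring

variable [FiniteDimensional ℂ V]

/-- Splitting off a longest chain of `T` for a positive eigenvalue of `T²`. -/
theorem exists_chain_of_pos {μ : ℝ} (hμ : 0 < μ)
    (hex : ∃ x, x ≠ 0 ∧ T (T x) = (μ : ℂ) • x) :
    ∃ (W : Submodule ℂ V) (k : ℕ) (x : ℕ → V), 0 < k ∧ (∀ w ∈ W, T w ∈ W) ∧ x 0 = 0 ∧
      (∀ j < k, T (x (j + 1)) = ((√μ : ℝ) : ℂ) • x (j + 1) + x j) ∧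
      Submodule.span ℂ (Set.range (fun j : Fin k => x (j + 1))) ⊔ W = ⊤ ∧
      finrank ℂ W + k = finrank ℂ V := by
  set s := √μ with hs
  have hs0 : s ≠ 0 := (Real.sqrt_pos.mpr hμ).ne'
  have hss : s * s = μ := Real.mul_self_sqrt hμ.le
  set N := antilinearSq T - algebraMap ℂ (End ℂ V) μ with hN
  set M := antilinearReal T - algebraMap ℝ (End ℝ V) s with hM
  set P := antilinearReal T + algebraMap ℝ (End ℝ V) s with hP
  set D := antilinearDualReal T - algebraMap ℝ (End ℝ (V →ₗ[ℂ] ℂ)) s with hD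
  have hNM : ∀ j x, (N ^ j) x = (M ^ j) ((P ^ j) x) := fun j x => by
    rw [hN, antilinearSq_sub_pow_apply, ← hss, mul_pow_add_sub, Module.End.mul_apply]
  have hPM : Commute P M := by
    have h := Algebra.commutes s (antilinearReal T)
    rw [commute_iff_eq, hP, hM, sub_mul, mul_add, mul_add, add_mul, mul_sub, mul_sub, h]
    abel
  obtain ⟨k, hk, u, hu, hu'⟩ := exists_index N (by
    obtain ⟨x, hx, hx'⟩ := hex
    refine ⟨x, hx, ?_⟩
    change T (T x) - (μ : ℂ) • x = 0
    rw [hx', sub_self])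
  -- `P` could kill $N^ku$, but not also $N^k(iu)$: by antilinearity $T(N^ku)$ would equal both
  -- $-sN^ku$ and $sN^ku$.
  obtain ⟨u, hu, hPu⟩ : ∃ u, (N ^ (k + 1)) u = 0 ∧ P ((N ^ k) u) ≠ 0 := by
    by_contra! hcon
    have h1 : T ((N ^ k) u) + s • (N ^ k) u = 0 := hcon u hu
    have h2 : T ((N ^ k) (Complex.I • u)) + s • (N ^ k) (Complex.I • u) = 0 :=
      hcon (Complex.I • u) (by rw [map_smul, hu, smul_zero])
    rw [map_smul, T.map_smulₛₗ, Complex.conj_I, smul_comm, neg_smul, ← smul_neg, ← smul_add] at h2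
    have h3 := (smul_eq_zero.mp h2).resolve_left Complex.I_ne_zero
    have h4 : (2 * s) • (N ^ k) u = 0 := by
      have : (2 * s) • (N ^ k) u = (T ((N ^ k) u) + s • (N ^ k) u) +
        (-T ((N ^ k) u) + s • (N ^ k) u) := by rw [two_mul, add_smul]; abel
      rw [this, h1, h3, add_zero]
    exact hu' ((smul_eq_zero.mp h4).resolve_left (by positivity))
  -- Since $N = MP$ over $\mathbb R$, applying $P^{k+1}$ turns a chain of `N` into a chain of `M`
  -- ending in $PN^ku \neq 0$.
  set v := (P ^ (k + 1)) u with hvdef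
  have hv : (M ^ (k + 1)) v = 0 := by rw [hvdef, ← hNM, hu]
  set v' := (M ^ k) v with hv'def
  have hv'eq : v' = P ((N ^ k) u) := by
    rw [hNM, hv'def, hvdef, ← Module.End.mul_apply, ← Module.End.mul_apply,
      ← Module.End.mul_apply, pow_succ', ← mul_assoc, (hPM.pow_right k).eq]
  have hv'0 : v' ≠ 0 := hv'eq ▸ hPu
  have hMv' : M v' = 0 := by
    rw [hv'def, ← Module.End.mul_apply, ← pow_succ']; exact hv
  have hTv' : T v' = s • v' := sub_eq_zero.mp hMv'
  have hmem : v' ∉ LinearMap.range (N ^ (k + 1)) := by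
    rintro ⟨w, hw⟩
    have h1 : (N ^ (k + 2)) w = 0 := by
      have h2 := hNM 1 v'
      rw [pow_one, pow_one, pow_one, ← Module.End.mul_apply, ← hPM.eq, Module.End.mul_apply, hMv',
        map_zero] at h2
      rw [pow_succ', Module.End.mul_apply, hw, h2]
    exact hv'0 (by rw [← hw, hk w h1])
  obtain ⟨f₁, hf₁, hf₁'⟩ := Submodule.exists_dual_map_eq_bot_of_notMem hmem inferInstance
  obtain ⟨f₀, hf₀, hf₀'⟩ : ∃ f₀ : V →ₗ[ℂ] ℂ, (∀ y, f₀ ((N ^ (k + 1)) y) = 0) ∧ f₀ v' = 1 := by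
    refine ⟨(f₁ v')⁻¹ • f₁, fun y => ?_, ?_⟩
    · have : f₁ ((N ^ (k + 1)) y) ∈ Submodule.map f₁ (LinearMap.range (N ^ (k + 1))) :=
        Submodule.mem_map_of_mem ⟨y, rfl⟩
      rw [hf₁', Submodule.mem_bot] at this
      rw [LinearMap.smul_apply, this, smul_zero]
    · rw [LinearMap.smul_apply, smul_eq_mul, inv_mul_cancel₀ hf₁]
  -- The dual counterpart of `v`: this factor makes $D^{k+1}f = f_0\circ N^{k+1} = 0$, while `f v'`
  -- stays nonzero because $s \ne 0$.
  set f := ((antilinearDualReal T + algebraMap ℝ (End ℝ (V →ₗ[ℂ] ℂ)) s) ^ (k + 1)) f₀ with hf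
  have hfv' : f v' = ((2 * s) ^ (k + 1) : ℝ) := add_pow_apply_of_eigenvector T hTv' hf₀' (k + 1)
  have hDf : (D ^ (k + 1)) f = 0 := by
    rw [hf, hD, ← Module.End.mul_apply, ← mul_pow_add_sub, hss]
    ext y
    rw [antilinearDualReal_sq_sub_pow_apply, ← hN, hf₀]
    rfl
  have hDbig : ∀ i, k < i → (D ^ i) f = 0 := by
    intro i hi
    obtain ⟨d, rfl⟩ := Nat.exists_eq_add_of_le' (show k + 1 ≤ i from hi)
    rw [pow_add, Module.End.mul_apply, hDf, map_zero]
  have hpair : ∀ i j, (D ^ i) f ((M ^ j) v) = ((f ((M ^ (i + j)) v)).re : ℝ) := by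
    intro i j
    apply Complex.ext
    · rw [Complex.ofReal_re, hD, re_pow_apply, ← Module.End.mul_apply, ← pow_add]
    · rw [Complex.ofReal_im]
      refine im_apply_eq_zero T hs0 _ (k + 1) (k + 1) _ _ rfl ?_ ?_
      · rw [← hD, ← Module.End.mul_apply, ← pow_add, add_comm, pow_add, Module.End.mul_apply, hDf,
          map_zero]
      · rw [← hM, ← Module.End.mul_apply, ← pow_add, add_comm, pow_add, Module.End.mul_apply, hv,
          map_zero]
  have hMbig : ∀ i, k < i → (M ^ i) v = 0 := by
    intro i hi
    obtain ⟨d, rfl⟩ := Nat.exists_eq_add_of_le' (show k + 1 ≤ i from hi)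
    rw [pow_add, Module.End.mul_apply, hv, map_zero]
  have htri := span_sup_ker_of_triangular (fun j : Fin (k + 1) => (M ^ (k + 1 - (j + 1))) v)
    (fun j => (D ^ (j : ℕ)) f) (fun j => k - (j : ℕ)) ?_ ?_
  · refine ⟨_, k + 1, fun j => (M ^ (k + 1 - j)) v, Nat.succ_pos k, ?_, hv, ?_, htri.1, ?_⟩
    · intro w hw
      rw [LinearMap.mem_ker, funext_iff] at hw ⊢
      intro j
      -- The kernel is invariant since $T^*D^jf = sD^jf + D^{j+1}f$ and $D^{k+1}f = 0$.
      have h1 : starRingEnd ℂ ((D ^ (j : ℕ)) f (T w)) =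
          s • (D ^ (j : ℕ)) f w + (D ^ ((j : ℕ) + 1)) f w :=
        LinearMap.congr_fun (sub_algebraMap_pow_apply (antilinearDualReal T) s j f) w
      have h2 : (D ^ (j : ℕ)) f w = 0 := hw j
      have h3 : (D ^ ((j : ℕ) + 1)) f w = 0 := by
        rcases Nat.lt_or_ge ((j : ℕ) + 1) (k + 1) with h | h
        · exact hw ⟨j + 1, h⟩
        · rw [hDbig _ h]; rfl
      rw [h2, h3, smul_zero, add_zero] at h1
      exact (map_eq_zero (starRingEnd ℂ)).mp h1
    · intro j hj
      have h1 := sub_algebraMap_pow_apply (antilinearReal T) s (k + 1 - (j + 1)) v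
      rw [show k + 1 - (j + 1) + 1 = k + 1 - j by omega] at h1
      rw [Complex.coe_smul]
      exact h1
    · rw [← htri.2, Fintype.card_fin]
  · intro j
    rw [hpair, show (j : ℕ) + (k + 1 - (j + 1)) = k by omega, ← hv'def, hfv', Complex.ofReal_re]
    exact_mod_cast pow_ne_zero _ (mul_ne_zero two_ne_zero hs0)
  · intro i j hij hle
    have : (i : ℕ) ≠ j := fun h => hij (Fin.ext h)
    change k - (i : ℕ) ≤ k - (j : ℕ) at hle
    rw [hpair, hMbig _ (by omega), map_zero]
    simp

end Antilinear

/-! ### Canonical bases of injective antilinear maps. -/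

namespace ConsimilarityData

/-- Adding a block `J_k(√μ)`. -/
def addPos (C : ConsimilarityData) (k : ℕ) (μ : ℝ) (hk : 0 < k) (hμ : 0 < μ) :
    ConsimilarityData :=
  { C with
    r := C.r + 1
    k := Fin.cons k C.k
    μ := Fin.cons μ C.μ
    k_pos := Fin.cases hk C.k_pos
    μ_pos := Fin.cases hμ C.μ_pos }

/-- Adding a block `[[0, I], [J_l(ν), 0]]` with `ν < 0`. -/
def addNeg (C : ConsimilarityData) (l : ℕ) (ν : ℝ) (hl : 0 < l) (hν : ν < 0) :
    ConsimilarityData :=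
  { C with
    s := C.s + 1
    l := Fin.cons l C.l
    ν := Fin.cons ν C.ν
    l_pos := Fin.cases hl C.l_pos
    ν_neg := Fin.cases hν C.ν_neg }

/-- Adding a block `[[0, I], [J_m(c), 0]]` with `c` nonreal. -/
def addNonreal (C : ConsimilarityData) (m : ℕ) (c : ℂ) (hm : 0 < m) (hc : c.im ≠ 0) :
    ConsimilarityData :=
  { C with
    u := C.u + 1
    m := Fin.cons m C.m
    c := Fin.cons c C.c
    m_pos := Fin.cases hm C.m_pos
    c_nonreal := Fin.cases hc C.c_nonreal }

end ConsimilarityData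

/-- The antilinear map `T` has a basis made of chains of `T` and of `T²`, with eigenvalues and
lengths as in the canonical form `C`. Chains start at index `1`. -/
def HasCanonicalChains {V : Type} [AddCommGroup V] [Module ℂ V]
    (T : V →ₛₗ[starRingEnd ℂ] V) (C : ConsimilarityData) : Prop :=
  ∃ (x : Fin C.r → ℕ → V) (y : Fin C.s → ℕ → V) (z : Fin C.u → ℕ → V),
    (∀ i, x i 0 = 0 ∧
      ∀ j < C.k i, T (x i (j + 1)) = ((√(C.μ i) : ℝ) : ℂ) • x i (j + 1) + x i j) ∧
    (∀ i, y i 0 = 0 ∧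
      ∀ j < C.l i, T (T (y i (j + 1))) = ((C.ν i : ℝ) : ℂ) • y i (j + 1) + y i j) ∧
    (∀ i, z i 0 = 0 ∧ ∀ j < C.m i, T (T (z i (j + 1))) = C.c i • z i (j + 1) + z i j) ∧
    (∀ U : Submodule ℂ V, (∀ i, ∀ j < C.k i, x i (j + 1) ∈ U) →
      (∀ i, ∀ j < C.l i, T (y i (j + 1)) ∈ U ∧ y i (j + 1) ∈ U) →
      (∀ i, ∀ j < C.m i, T (z i (j + 1)) ∈ U ∧ z i (j + 1) ∈ U) → U = ⊤) ∧
    finrank ℂ V = C.numPos + (C.numNeg + C.numNeg) + (C.numNonreal + C.numNonreal)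

section Extend

variable {V : Type} [AddCommGroup V] [Module ℂ V] {T : V →ₛₗ[starRingEnd ℂ] V}
  {W : Submodule ℂ V} {TW : W →ₛₗ[starRingEnd ℂ] W} {C : ConsimilarityData}

theorem HasCanonicalChains.addPos (hTW : ∀ w, (TW w : V) = T w) (h : HasCanonicalChains TW C)
    {k : ℕ} {μ : ℝ} (hk : 0 < k) (hμ : 0 < μ) {v : ℕ → V} (hv0 : v 0 = 0)
    (hv : ∀ j < k, T (v (j + 1)) = ((√μ : ℝ) : ℂ) • v (j + 1) + v j)
    (hspan : Submodule.span ℂ (Set.range (fun j : Fin k => v (j + 1))) ⊔ W = ⊤)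
    (hdim : finrank ℂ W + k = finrank ℂ V) :
    HasCanonicalChains T (C.addPos k μ hk hμ) := by
  obtain ⟨x, y, z, hx, hy, hz, hU, hd⟩ := h
  refine ⟨Fin.cons v fun i j => (x i j : V), fun i j => (y i j : V), fun i j => (z i j : V),
    ?_, ?_, ?_, ?_, ?_⟩
  · refine Fin.cases ⟨hv0, hv⟩ fun i => ⟨congrArg Subtype.val (hx i).1, fun j hj => ?_⟩
    have := congrArg Subtype.val ((hx i).2 j hj)
    rw [hTW] at this
    exact this
  · refine fun i => ⟨congrArg Subtype.val (hy i).1, fun j hj => ?_⟩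
    have := congrArg Subtype.val ((hy i).2 j hj)
    rw [hTW, hTW] at this
    exact this
  · refine fun i => ⟨congrArg Subtype.val (hz i).1, fun j hj => ?_⟩
    have := congrArg Subtype.val ((hz i).2 j hj)
    rw [hTW, hTW] at this
    exact this
  · intro U h1 h2 h3
    have hW : U.comap W.subtype = ⊤ := by
      refine hU _ (fun i j hj => h1 i.succ j hj) (fun i j hj => ⟨?_, (h2 i j hj).2⟩)
        (fun i j hj => ⟨?_, (h3 i j hj).2⟩)
      · have := (h2 i j hj).1
        rw [← hTW] at this
        exact this
      · have := (h3 i j hj).1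
        rw [← hTW] at this
        exact this
    rw [eq_top_iff, ← hspan]
    refine sup_le (Submodule.span_le.mpr ?_) (Submodule.comap_subtype_eq_top.mp hW)
    rintro _ ⟨j, rfl⟩
    exact h1 (0 : Fin (C.r + 1)) j j.2
  · have : (C.addPos k μ hk hμ).numPos = k + C.numPos := Fin.sum_univ_succ _
    have h2 : (C.addPos k μ hk hμ).numNeg = C.numNeg := rfl
    have h3 : (C.addPos k μ hk hμ).numNonreal = C.numNonreal := rfl
    omega

theorem HasCanonicalChains.addNeg (hTW : ∀ w, (TW w : V) = T w) (h : HasCanonicalChains TW C)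
    {k : ℕ} {ν : ℝ} (hk : 0 < k) (hν : ν < 0) {v : ℕ → V} (hv0 : v 0 = 0)
    (hv : ∀ j < k, T (T (v (j + 1))) = ((ν : ℝ) : ℂ) • v (j + 1) + v j)
    (hspan : Submodule.span ℂ (Set.range (Sum.elim (fun j : Fin k => T (v (j + 1)))
        (fun j : Fin k => v (j + 1)))) ⊔ W = ⊤)
    (hdim : finrank ℂ W + (k + k) = finrank ℂ V) :
    HasCanonicalChains T (C.addNeg k ν hk hν) := by
  obtain ⟨x, y, z, hx, hy, hz, hU, hd⟩ := h
  refine ⟨fun i j => (x i j : V), Fin.cons v fun i j => (y i j : V), fun i j => (z i j : V),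
    ?_, ?_, ?_, ?_, ?_⟩
  · refine fun i => ⟨congrArg Subtype.val (hx i).1, fun j hj => ?_⟩
    have := congrArg Subtype.val ((hx i).2 j hj)
    rw [hTW] at this
    exact this
  · refine Fin.cases ⟨hv0, hv⟩ fun i => ⟨congrArg Subtype.val (hy i).1, fun j hj => ?_⟩
    have := congrArg Subtype.val ((hy i).2 j hj)
    rw [hTW, hTW] at this
    exact this
  · refine fun i => ⟨congrArg Subtype.val (hz i).1, fun j hj => ?_⟩
    have := congrArg Subtype.val ((hz i).2 j hj)
    rw [hTW, hTW] at this
    exact this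
  · intro U h1 h2 h3
    have hW : U.comap W.subtype = ⊤ := by
      refine hU _ (fun i j hj => h1 i j hj) (fun i j hj => ⟨?_, (h2 i.succ j hj).2⟩)
        (fun i j hj => ⟨?_, (h3 i j hj).2⟩)
      · have : T (y i (j + 1) : V) ∈ U := (h2 i.succ j hj).1
        rw [← hTW] at this
        exact this
      · have := (h3 i j hj).1
        rw [← hTW] at this
        exact this
    rw [eq_top_iff, ← hspan]
    refine sup_le (Submodule.span_le.mpr ?_) (Submodule.comap_subtype_eq_top.mp hW)
    rintro _ ⟨j | j, rfl⟩
    · exact (h2 (0 : Fin (C.s + 1)) j j.2).1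
    · exact (h2 (0 : Fin (C.s + 1)) j j.2).2
  · have : (C.addNeg k ν hk hν).numNeg = k + C.numNeg := Fin.sum_univ_succ _
    have h2 : (C.addNeg k ν hk hν).numPos = C.numPos := rfl
    have h3 : (C.addNeg k ν hk hν).numNonreal = C.numNonreal := rfl
    omega

theorem HasCanonicalChains.addNonreal (hTW : ∀ w, (TW w : V) = T w) (h : HasCanonicalChains TW C)
    {k : ℕ} {c : ℂ} (hk : 0 < k) (hc : c.im ≠ 0) {v : ℕ → V} (hv0 : v 0 = 0)
    (hv : ∀ j < k, T (T (v (j + 1))) = c • v (j + 1) + v j)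
    (hspan : Submodule.span ℂ (Set.range (Sum.elim (fun j : Fin k => T (v (j + 1)))
        (fun j : Fin k => v (j + 1)))) ⊔ W = ⊤)
    (hdim : finrank ℂ W + (k + k) = finrank ℂ V) :
    HasCanonicalChains T (C.addNonreal k c hk hc) := by
  obtain ⟨x, y, z, hx, hy, hz, hU, hd⟩ := h
  refine ⟨fun i j => (x i j : V), fun i j => (y i j : V), Fin.cons v fun i j => (z i j : V),
    ?_, ?_, ?_, ?_, ?_⟩
  · refine fun i => ⟨congrArg Subtype.val (hx i).1, fun j hj => ?_⟩
    have := congrArg Subtype.val ((hx i).2 j hj)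
    rw [hTW] at this
    exact this
  · refine fun i => ⟨congrArg Subtype.val (hy i).1, fun j hj => ?_⟩
    have := congrArg Subtype.val ((hy i).2 j hj)
    rw [hTW, hTW] at this
    exact this
  · refine Fin.cases ⟨hv0, hv⟩ fun i => ⟨congrArg Subtype.val (hz i).1, fun j hj => ?_⟩
    have := congrArg Subtype.val ((hz i).2 j hj)
    rw [hTW, hTW] at this
    exact this
  · intro U h1 h2 h3
    have hW : U.comap W.subtype = ⊤ := by
      refine hU _ (fun i j hj => h1 i j hj) (fun i j hj => ⟨?_, (h2 i j hj).2⟩)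
        (fun i j hj => ⟨?_, (h3 i.succ j hj).2⟩)
      · have := (h2 i j hj).1
        rw [← hTW] at this
        exact this
      · have : T (z i (j + 1) : V) ∈ U := (h3 i.succ j hj).1
        rw [← hTW] at this
        exact this
    rw [eq_top_iff, ← hspan]
    refine sup_le (Submodule.span_le.mpr ?_) (Submodule.comap_subtype_eq_top.mp hW)
    rintro _ ⟨j | j, rfl⟩
    · exact (h3 (0 : Fin (C.u + 1)) j j.2).1
    · exact (h3 (0 : Fin (C.u + 1)) j j.2).2
  · have : (C.addNonreal k c hk hc).numNonreal = k + C.numNonreal := Fin.sum_univ_succ _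
    have h2 : (C.addNonreal k c hk hc).numPos = C.numPos := rfl
    have h3 : (C.addNonreal k c hk hc).numNeg = C.numNeg := rfl
    omega

end Extend

/-- Every injective antilinear map of a finite-dimensional space has a canonical basis. -/
theorem exists_hasCanonicalChains (d : ℕ) : ∀ {V : Type} [AddCommGroup V] [Module ℂ V]
    [FiniteDimensional ℂ V] (T : V →ₛₗ[starRingEnd ℂ] V), Function.Injective T →
    finrank ℂ V = d → ∃ C, HasCanonicalChains T C := by
  induction d using Nat.strong_induction_on with
  | _ d ih =>
  intro V _ _ _ T hT hd
  rcases Nat.eq_zero_or_pos d with rfl | hpos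
  · have hsub : Subsingleton V := finrank_zero_iff.mp hd
    refine ⟨⟨0, 0, 0, Fin.elim0, Fin.elim0, Fin.elim0, Fin.elim0, Fin.elim0, Fin.elim0,
      fun i => i.elim0, fun i => i.elim0, fun i => i.elim0, fun i => i.elim0, fun i => i.elim0,
      fun i => i.elim0⟩, Fin.elim0, Fin.elim0, Fin.elim0, fun i => i.elim0, fun i => i.elim0,
      fun i => i.elim0, fun U _ _ _ => Subsingleton.elim _ _, ?_⟩
    simp [hd, ConsimilarityData.numPos, ConsimilarityData.numNeg, ConsimilarityData.numNonreal]
  have hnt : Nontrivial V := finrank_pos_iff.mp (hd ▸ hpos)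
  obtain ⟨c, hc⟩ := Module.End.exists_eigenvalue (antilinearSq T)
  obtain ⟨u, hu⟩ := hc.exists_hasEigenvector
  have hex : ∃ x, x ≠ 0 ∧ T (T x) = c • x := ⟨u, hu.2, hu.apply_eq_smul⟩
  -- Injectivity of `T` passes to its square and to invariant subspaces, so zero never occurs as an
  -- eigenvalue in the induction.
  have hc0 : c ≠ 0 := by
    rintro rfl
    obtain ⟨x, hx, hx'⟩ := hex
    rw [zero_smul] at hx'
    exact hx (hT (by rw [map_zero]; exact hT (by rw [hx', map_zero])))
  have hrestrict : ∀ W : Submodule ℂ V, (∀ w ∈ W, T w ∈ W) →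
      finrank ℂ W < d → ∃ TW : W →ₛₗ[starRingEnd ℂ] W, (∀ w, (TW w : V) = T w) ∧
        ∃ C, HasCanonicalChains TW C := by
    intro W hW hlt
    refine ⟨(T.comp W.subtype).codRestrict W fun w => hW w w.2, fun _ => rfl, ?_⟩
    refine ih _ hlt _ (fun a b hab => ?_) rfl
    exact Subtype.ext (hT (congrArg Subtype.val hab))
  by_cases him : c.im = 0
  · obtain ⟨r, rfl⟩ : ∃ r : ℝ, c = r := ⟨c.re, Complex.ext rfl him⟩
    rcases lt_or_gt_of_ne (fun h : r = 0 => hc0 (by rw [h, Complex.ofReal_zero])) with hr | hr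
    · obtain ⟨W, k, x, hk, hW, hx0, hx, hs, hdim⟩ :=
        exists_chain_of_not_pos T (Or.inr ⟨him, hr⟩) hex
      obtain ⟨TW, hTW, C, hC⟩ := hrestrict W hW (by omega)
      exact ⟨_, hC.addNeg hTW hk hr hx0 hx hs hdim⟩
    · obtain ⟨W, k, x, hk, hW, hx0, hx, hs, hdim⟩ := exists_chain_of_pos T hr hex
      obtain ⟨TW, hTW, C, hC⟩ := hrestrict W hW (by omega)
      exact ⟨_, hC.addPos hTW hk hr hx0 hx hs hdim⟩
  · obtain ⟨W, k, x, hk, hW, hx0, hx, hs, hdim⟩ :=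
      exists_chain_of_not_pos T (Or.inl him) hex
    obtain ⟨TW, hTW, C, hC⟩ := hrestrict W hW (by omega)
    exact ⟨_, hC.addNonreal hTW hk him hx0 hx hs hdim⟩

/-! ### From canonical bases to canonical forms of matrices. -/

theorem sum_jordanBlock_smul {V : Type} [AddCommGroup V] [Module ℂ V] {k : ℕ} (a : ℂ)
    (x : ℕ → V) (hx : x 0 = 0) (j : Fin k) :
    ∑ i : Fin k, jordanBlock k a i j • x (i + 1) = a • x (j + 1) + x j := by
  have h1 : ∀ i : Fin k, jordanBlock k a i j • x (i + 1) =
      (if i = j then a • x (j + 1) else 0) + (if (i : ℕ) + 1 = j then x j else 0) := by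
    intro i
    simp only [jordanBlock, Matrix.of_apply]
    split_ifs with h1 h2 h2
    · rw [h1] at h2; omega
    · rw [h1, add_zero]
    · rw [h2, one_smul, zero_add]
    · rw [zero_smul, add_zero]
  rw [Finset.sum_congr rfl fun i _ => h1 i, Finset.sum_add_distrib, Finset.sum_ite_eq' _ j]
  simp only [Finset.mem_univ, if_true]
  congr 1
  rcases Nat.eq_zero_or_pos (j : ℕ) with h | h
  -- The first column has no superdiagonal entry; the convention `x 0 = 0` supplies the missing
  -- term.
  · rw [h, hx]; simp
  · rw [Finset.sum_eq_single ⟨j - 1, by omega⟩]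
    · rw [if_pos (by simp only; omega)]
    · intro i _ hi
      rw [if_neg]
      intro h2
      exact hi (Fin.ext (by simp only; omega))
    · simp

theorem sum_blockDiagonal'_smul {V ι : Type} [AddCommGroup V] [Module ℂ V] [Fintype ι]
    [DecidableEq ι] {m : ι → Type} [∀ i, Fintype (m i)] (M : ∀ i, Matrix (m i) (m i) ℂ)
    (g : (Σ i, m i) → V) (i : ι) (j : m i) :
    ∑ p, Matrix.blockDiagonal' M p ⟨i, j⟩ • g p = ∑ j', M i j' j • g ⟨i, j'⟩ := by
  rw [Fintype.sum_sigma, Finset.sum_eq_single i]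
  · simp [Matrix.blockDiagonal'_apply_eq]
  · intro i' _ hi'
    refine Finset.sum_eq_zero fun j' _ => ?_
    rw [Matrix.blockDiagonal'_apply_ne _ _ _ hi', zero_smul]
  · simp

theorem ConsimilarityData.card_index (C : ConsimilarityData) :
    Fintype.card C.Index = C.numPos + (C.numNeg + C.numNeg) + (C.numNonreal + C.numNonreal) := by
  simp [ConsimilarityData.Index, ConsimilarityData.numPos, ConsimilarityData.numNeg,
    ConsimilarityData.numNonreal, Finset.sum_add_distrib, add_assoc]

/-- The antilinear map `v ↦ A v̄`. -/
def matrixAntilinear {n : ℕ} (A : Matrix (Fin n) (Fin n) ℂ) :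
    (Fin n → ℂ) →ₛₗ[starRingEnd ℂ] (Fin n → ℂ) where
  toFun v := A *ᵥ (fun i => starRingEnd ℂ (v i))
  map_add' v w := by
    rw [← Matrix.mulVec_add]
    congr 1
    ext i
    simp
  map_smul' c v := by
    rw [← Matrix.mulVec_smul]
    congr 1
    ext i
    simp

theorem conjMatrix_mul {ι : Type*} [Fintype ι] (A B : Matrix ι ι ℂ) :
    conjMatrix (A * B) = conjMatrix A * conjMatrix B := Matrix.map_mul

theorem conjMatrix_one {ι : Type*} [DecidableEq ι] : conjMatrix (1 : Matrix ι ι ℂ) = 1 :=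
  Matrix.map_one _ (map_zero _) (map_one _)

theorem conjMatrix_inv {ι : Type*} [Fintype ι] [DecidableEq ι] {A : Matrix ι ι ℂ}
    (hA : IsUnit A.det) : (conjMatrix A)⁻¹ = conjMatrix A⁻¹ := by
  refine Matrix.inv_eq_right_inv ?_
  rw [← conjMatrix_mul, Matrix.mul_nonsing_inv _ hA, conjMatrix_one]

theorem conjMatrix_conjMatrix {ι : Type*} (A : Matrix ι ι ℂ) : conjMatrix (conjMatrix A) = A := by
  ext i j
  simp [conjMatrix]

/-- The chain vectors span and have the right number, so they form a basis. With them as the columns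
of `P`, the chain relations say $A\bar P = PC$ up to numbering, and $P^{-1}$ realises the
consimilarity. -/
theorem HasCanonicalChains.hasCanonicalForm {n : ℕ} {A : Matrix (Fin n) (Fin n) ℂ}
    {C : ConsimilarityData} (h : HasCanonicalChains (matrixAntilinear A) C) :
    HasCanonicalForm A C := by
  obtain ⟨x, y, z, hx, hy, hz, hU, hd⟩ := h
  set T := matrixAntilinear A
  rw [finrank_fin_fun, ← C.card_index] at hd
  let b : C.Index → Fin n → ℂ := Sum.elim (fun p => x p.1 (p.2 + 1))
    (Sum.elim (fun p => Sum.elim (fun j : Fin (C.l p.1) => T (y p.1 (j + 1)))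
        (fun j : Fin (C.l p.1) => y p.1 (j + 1)) p.2)
      (fun p => Sum.elim (fun j : Fin (C.m p.1) => T (z p.1 (j + 1)))
        (fun j : Fin (C.m p.1) => z p.1 (j + 1)) p.2))
  have hspan : ⊤ ≤ Submodule.span ℂ (Set.range b) := by
    rw [hU (Submodule.span ℂ (Set.range b))]
    · intro i j hj
      exact Submodule.subset_span ⟨Sum.inl ⟨i, ⟨j, hj⟩⟩, rfl⟩
    · intro i j hj
      exact ⟨Submodule.subset_span ⟨Sum.inr (Sum.inl ⟨i, Sum.inl ⟨j, hj⟩⟩), rfl⟩,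
        Submodule.subset_span ⟨Sum.inr (Sum.inl ⟨i, Sum.inr ⟨j, hj⟩⟩), rfl⟩⟩
    · intro i j hj
      exact ⟨Submodule.subset_span ⟨Sum.inr (Sum.inr ⟨i, Sum.inl ⟨j, hj⟩⟩), rfl⟩,
        Submodule.subset_span ⟨Sum.inr (Sum.inr ⟨i, Sum.inr ⟨j, hj⟩⟩), rfl⟩⟩
  have hT : ∀ j, T (b j) = ∑ i, C.toMatrix i j • b i := by
    rintro (⟨i, j⟩ | ⟨i, j⟩ | ⟨i, j⟩)
    · rw [Fintype.sum_sum_type, Fintype.sum_sum_type]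
      simp only [ConsimilarityData.toMatrix, Matrix.fromBlocks_apply₁₁, Matrix.fromBlocks_apply₂₁,
        Matrix.zero_apply, zero_smul, Finset.sum_const_zero, add_zero]
      rw [sum_blockDiagonal'_smul _ (fun p => b (Sum.inl p))]
      exact ((hx i).2 j j.2).trans (sum_jordanBlock_smul _ _ (hx i).1 j).symm
    · rw [Fintype.sum_sum_type, Fintype.sum_sum_type]
      simp only [ConsimilarityData.toMatrix, Matrix.fromBlocks_apply₁₁, Matrix.fromBlocks_apply₂₁,
        Matrix.fromBlocks_apply₁₂, Matrix.fromBlocks_apply₂₂,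
        Matrix.zero_apply, zero_smul, Finset.sum_const_zero, add_zero, zero_add]
      rw [sum_blockDiagonal'_smul _ (fun p => b (Sum.inr (Sum.inl p))), Fintype.sum_sum_type]
      rcases j with j | j
      · simp only [doubledJordanBlock, Matrix.fromBlocks_apply₁₁, Matrix.fromBlocks_apply₂₁,
          Matrix.zero_apply, zero_smul, Finset.sum_const_zero, zero_add]
        exact ((hy i).2 j j.2).trans (sum_jordanBlock_smul _ _ (hy i).1 j).symm
      · simp [doubledJordanBlock, Matrix.one_apply, b]
    · rw [Fintype.sum_sum_type, Fintype.sum_sum_type]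
      simp only [ConsimilarityData.toMatrix, Matrix.fromBlocks_apply₁₂, Matrix.fromBlocks_apply₂₂,
        Matrix.zero_apply, zero_smul, Finset.sum_const_zero, zero_add]
      rw [sum_blockDiagonal'_smul _ (fun p => b (Sum.inr (Sum.inr p))), Fintype.sum_sum_type]
      rcases j with j | j
      · simp only [doubledJordanBlock, Matrix.fromBlocks_apply₁₁, Matrix.fromBlocks_apply₂₁,
          Matrix.zero_apply, zero_smul, Finset.sum_const_zero, zero_add]
        exact ((hz i).2 j j.2).trans (sum_jordanBlock_smul _ _ (hz i).1 j).symm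
      · simp [doubledJordanBlock, Matrix.one_apply, b]
  have hli : LinearIndependent ℂ b :=
    linearIndependent_of_top_le_span_of_card_eq_finrank hspan (by rw [finrank_fin_fun, hd])
  let e : C.Index ≃ Fin n := Fintype.equivFinOfCardEq hd.symm
  let P : Matrix (Fin n) (Fin n) ℂ := Matrix.of fun i j => b (e.symm j) i
  have hP : IsUnit P.det := by
    rw [← Matrix.isUnit_iff_isUnit_det, ← Matrix.linearIndependent_cols_iff_isUnit]
    exact hli.comp _ e.symm.injective
  have hAP : A * conjMatrix P = P * Matrix.reindex e e C.toMatrix := by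
    ext i j
    have h1 := congrFun (hT (e.symm j)) i
    rw [Finset.sum_apply] at h1
    rw [Matrix.mul_apply, Matrix.mul_apply]
    refine h1.trans (Eq.trans (Finset.sum_congr rfl fun p _ => ?_)
      (e.sum_comp fun t => P i t * Matrix.reindex e e C.toMatrix t j))
    simp [P, mul_comm]
  refine ⟨e, P⁻¹, ?_, ?_⟩
  · exact (Matrix.isUnit_nonsing_inv_det_iff).mpr hP
  · rw [conjMatrix_inv ((Matrix.isUnit_nonsing_inv_det_iff).mpr hP),
      Matrix.nonsing_inv_nonsing_inv _ hP, mul_assoc, hAP, ← mul_assoc, Matrix.nonsing_inv_mul _ hP, one_mul]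

theorem exists_hasCanonicalForm {n : ℕ} (A : Matrix (Fin n) (Fin n) ℂ) (hA : IsUnit A.det) :
    ∃ C : ConsimilarityData, HasCanonicalForm A C := by
  obtain ⟨C, hC⟩ := exists_hasCanonicalChains _ (matrixAntilinear A) (fun v w hvw => by
    have h1 : (fun i => starRingEnd ℂ (v i)) = (fun i => starRingEnd ℂ (w i)) :=
      Matrix.mulVec_injective_of_isUnit ((Matrix.isUnit_iff_isUnit_det _).mpr hA) hvw
    ext i
    exact (starRingEnd ℂ).injective (congrFun h1 i)) rfl
  exact ⟨C, hC.hasCanonicalForm⟩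

end

/-! ### The spectrum of $A\bar A$ as an invariant. -/

section

open Polynomial

theorem charpoly_of_triangular {ι α : Type} [Fintype ι] [DecidableEq ι] [LinearOrder α]
    (M : Matrix ι ι ℂ) (b : ι → α) (hb : Function.Injective b) (h : M.BlockTriangular b) :
    M.charpoly = ∏ i, (X - C (M i i)) := by
  let : LinearOrder ι := LinearOrder.lift' b hb
  have := Matrix.charpoly_of_isUpperTriangular M h
  convert this

theorem roots_charpoly_blockDiagonal' {r : ℕ} {k : Fin r → ℕ}
    (U : ∀ i, Matrix (Fin (k i)) (Fin (k i)) ℂ) (hU : ∀ i, ∀ j j', j' < j → U i j j' = 0) :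
    (Matrix.blockDiagonal' U).charpoly.roots =
      (Finset.univ : Finset (Σ i, Fin (k i))).val.map fun p => U p.1 p.2 p.2 := by
  rw [charpoly_of_triangular (Matrix.blockDiagonal' U)
    -- Ordering by block number and then by position makes the whole block diagonal matrix
    -- triangular.
    (fun p : Σ i, Fin (k i) => toLex ((p.1 : ℕ), (p.2 : ℕ)))]
  · have : (∏ p : Σ i, Fin (k i), (X - C (Matrix.blockDiagonal' U p p))) =
        (((Finset.univ : Finset (Σ i, Fin (k i))).val.map fun p => U p.1 p.2 p.2).map
          fun a => X - C a).prod := by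
      rw [Multiset.map_map]
      refine congrArg Multiset.prod (Multiset.map_congr rfl ?_)
      rintro ⟨i, j⟩ _
      simp [Matrix.blockDiagonal'_apply_eq]
    rw [this, roots_multiset_prod_X_sub_C]
  · rintro ⟨i, j⟩ ⟨i', j'⟩ h
    have h1 := congrArg (fun z => (ofLex z).1) h
    have h2 := congrArg (fun z => (ofLex z).2) h
    obtain rfl : i = i' := Fin.ext h1
    obtain rfl : j = j' := Fin.ext h2
    rfl
  · rintro ⟨i, j⟩ ⟨i', j'⟩ h
    rw [Prod.Lex.toLex_lt_toLex] at h
    by_cases hi : i = i'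
    · subst hi
      rw [Matrix.blockDiagonal'_apply_eq]
      refine hU i _ _ ?_
      rcases h with h | h
      · exact absurd h (lt_irrefl _)
      · exact h.2
    · exact Matrix.blockDiagonal'_apply_ne _ _ _ hi

/-- The eigenvalues of `A Ā`, with algebraic multiplicities. -/
noncomputable def consimilaritySpectrum {ι : Type*} [Fintype ι] [DecidableEq ι]
    (A : Matrix ι ι ℂ) : Multiset ℂ :=
  (A * conjMatrix A).charpoly.roots

/-- The inner conjugate factors cancel: $B\bar B = S(A\bar A)S^{-1}$. -/
theorem Consimilar.consimilaritySpectrum_eq {ι : Type*} [Fintype ι] [DecidableEq ι]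
    {A B : Matrix ι ι ℂ} (h : Consimilar A B) :
    consimilaritySpectrum B = consimilaritySpectrum A := by
  obtain ⟨S, hS, rfl⟩ := h
  have hS' := (Matrix.isUnit_iff_isUnit_det S).mpr hS
  have h1 : S * A * (conjMatrix S)⁻¹ * conjMatrix (S * A * (conjMatrix S)⁻¹) =
      S * (A * conjMatrix A) * S⁻¹ := by
    rw [conjMatrix_inv hS, conjMatrix_mul, conjMatrix_mul, conjMatrix_conjMatrix]
    have h2 : conjMatrix S⁻¹ * conjMatrix S = 1 := by
      rw [← conjMatrix_mul, Matrix.nonsing_inv_mul _ hS, conjMatrix_one]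
    calc S * A * conjMatrix S⁻¹ * (conjMatrix S * conjMatrix A * S⁻¹)
        = S * A * (conjMatrix S⁻¹ * conjMatrix S) * conjMatrix A * S⁻¹ := by
          simp only [mul_assoc]
      _ = _ := by rw [h2, mul_one]; simp only [mul_assoc]
  rw [consimilaritySpectrum, consimilaritySpectrum, h1, Matrix.charpoly_mul_comm, ← mul_assoc,
    Matrix.nonsing_inv_mul _ hS, one_mul]

theorem conjMatrix_reindex {ι κ : Type*} (e : ι ≃ κ) (A : Matrix ι ι ℂ) :
    conjMatrix (Matrix.reindex e e A) = Matrix.reindex e e (conjMatrix A) := rfl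

theorem consimilaritySpectrum_reindex {ι κ : Type*} [Fintype ι] [DecidableEq ι] [Fintype κ]
    [DecidableEq κ] (e : ι ≃ κ) (A : Matrix ι ι ℂ) :
    consimilaritySpectrum (Matrix.reindex e e A) = consimilaritySpectrum A := by
  rw [consimilaritySpectrum, conjMatrix_reindex]
  have : Matrix.reindex e e A * Matrix.reindex e e (conjMatrix A) =
      Matrix.reindex e e (A * conjMatrix A) := by
    simp [Matrix.reindex_apply, Matrix.submatrix_mul_equiv]
  rw [this, Matrix.charpoly_reindex, consimilaritySpectrum]

theorem consimilaritySpectrum_fromBlocks {ι κ : Type*} [Fintype ι] [DecidableEq ι] [Fintype κ]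
    [DecidableEq κ] (A : Matrix ι ι ℂ) (D : Matrix κ κ ℂ) :
    consimilaritySpectrum (Matrix.fromBlocks A 0 0 D) =
      consimilaritySpectrum A + consimilaritySpectrum D := by
  have h1 : conjMatrix (Matrix.fromBlocks A 0 0 D) =
      Matrix.fromBlocks (conjMatrix A) 0 0 (conjMatrix D) := by
    simp [conjMatrix, Matrix.fromBlocks_map]
  rw [consimilaritySpectrum, h1, Matrix.fromBlocks_multiply]
  simp only [Matrix.mul_zero, Matrix.zero_mul, add_zero, zero_add]
  rw [Matrix.charpoly_fromBlocks_zero₁₂, roots_mul]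
  · rfl
  · exact ((Matrix.charpoly_monic _).mul (Matrix.charpoly_monic _)).ne_zero

/-- The upper bidiagonal matrix with diagonal `d` and ones on the superdiagonal. -/
def upperBidiagonal {k : ℕ} (d : Fin k → ℂ) : Matrix (Fin k) (Fin k) ℂ :=
  Matrix.of fun i j => if i = j then d i else if (i : ℕ) + 1 = (j : ℕ) then 1 else 0

theorem upperBidiagonal_apply_self {k : ℕ} (d : Fin k → ℂ) (i : Fin k) :
    upperBidiagonal d i i = d i := by simp [upperBidiagonal]

theorem upperBidiagonal_apply_of_lt {k : ℕ} (d : Fin k → ℂ) {i j : Fin k} (h : j < i) :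
    upperBidiagonal d i j = 0 := by
  have h' : (j : ℕ) < i := h
  simp only [upperBidiagonal, Matrix.of_apply]
  rw [if_neg h.ne', if_neg (by omega)]

theorem consimilaritySpectrum_blockDiagonal'_upperBidiagonal {r : ℕ} {k : Fin r → ℕ}
    (d : (Σ i, Fin (k i)) → ℂ) :
    consimilaritySpectrum (Matrix.blockDiagonal' fun i => upperBidiagonal fun j => d ⟨i, j⟩) =
      Finset.univ.val.map fun p => d p * starRingEnd ℂ (d p) := by
  have h1 : conjMatrix (Matrix.blockDiagonal' fun i => upperBidiagonal fun j => d ⟨i, j⟩) =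
      Matrix.blockDiagonal' fun i => conjMatrix (upperBidiagonal fun j => d ⟨i, j⟩) :=
    Matrix.blockDiagonal'_map _ _ (map_zero _)
  rw [consimilaritySpectrum, h1, ← Matrix.blockDiagonal'_mul, roots_charpoly_blockDiagonal']
  · refine Multiset.map_congr rfl ?_
    rintro ⟨i, j⟩ _
    simp only [Matrix.mul_apply]
    rw [Finset.sum_eq_single j]
    · simp [conjMatrix, upperBidiagonal_apply_self]
    · intro j' _ hj'
      rcases lt_or_gt_of_ne hj' with h | h
      · rw [upperBidiagonal_apply_of_lt _ h, zero_mul]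
      · simp [conjMatrix, upperBidiagonal_apply_of_lt _ h]
    · simp
  · intro i j j' h
    rw [Matrix.mul_apply]
    refine Finset.sum_eq_zero fun t _ => ?_
    rcases lt_or_ge t j with h2 | h2
    · rw [upperBidiagonal_apply_of_lt _ h2, zero_mul]
    · simp [conjMatrix, upperBidiagonal_apply_of_lt _ (h.trans_le h2)]

theorem consimilaritySpectrum_blockDiagonal'_doubled {r : ℕ} {k : Fin r → ℕ}
    (d : (Σ i, Fin (k i)) → ℂ) :
    consimilaritySpectrum (Matrix.blockDiagonal' fun i =>
      Matrix.fromBlocks 0 1 (upperBidiagonal fun j => d ⟨i, j⟩) 0) =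
      Finset.univ.val.map d + Finset.univ.val.map fun p => starRingEnd ℂ (d p) := by
  have h1 : conjMatrix (Matrix.blockDiagonal' fun i =>
      Matrix.fromBlocks 0 1 (upperBidiagonal fun j => d ⟨i, j⟩) 0) =
      Matrix.blockDiagonal' fun i =>
        Matrix.fromBlocks 0 1 (conjMatrix (upperBidiagonal fun j => d ⟨i, j⟩)) 0 := by
    refine (Matrix.blockDiagonal'_map _ _ (map_zero _)).trans (congrArg _ (funext fun i => ?_))
    rw [Matrix.fromBlocks_map]
    congr 1
    · exact Matrix.map_zero _ (map_zero _)
    · exact conjMatrix_one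
    · exact Matrix.map_zero _ (map_zero _)
  -- A doubled block times its conjugate is $\bar U \oplus U$. Regrouping the halves of all blocks
  -- leaves two triangular matrices.
  have h2 : (Matrix.blockDiagonal' fun i => Matrix.fromBlocks
      (conjMatrix (upperBidiagonal fun j => d ⟨i, j⟩)) 0 0 (upperBidiagonal fun j => d ⟨i, j⟩)) =
      Matrix.reindex (Equiv.sigmaSumDistrib _ _).symm (Equiv.sigmaSumDistrib _ _).symm
        (Matrix.fromBlocks
          (Matrix.blockDiagonal' fun i => conjMatrix (upperBidiagonal fun j => d ⟨i, j⟩)) 0 0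
          (Matrix.blockDiagonal' fun i => upperBidiagonal fun j => d ⟨i, j⟩)) := by
    ext ⟨i, j | j⟩ ⟨i', j' | j'⟩ <;> by_cases hi : i = i'
    all_goals first
      | (subst hi; simp [Matrix.blockDiagonal'_apply_eq])
      | simp [Matrix.blockDiagonal'_apply_ne _ _ _ hi]
  rw [consimilaritySpectrum, h1, ← Matrix.blockDiagonal'_mul]
  simp only [Matrix.fromBlocks_multiply, mul_zero, zero_mul, add_zero, zero_add, one_mul, mul_one]
  rw [h2, Matrix.charpoly_reindex, Matrix.charpoly_fromBlocks_zero₁₂, roots_mul,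
    roots_charpoly_blockDiagonal', roots_charpoly_blockDiagonal', add_comm]
  · simp [conjMatrix, upperBidiagonal_apply_self]
  · intro i j j' h
    exact upperBidiagonal_apply_of_lt _ h
  · intro i j j' h
    simp [conjMatrix, upperBidiagonal_apply_of_lt _ h]
  · exact ((Matrix.charpoly_monic _).mul (Matrix.charpoly_monic _)).ne_zero

namespace ConsimilarityData

/-- The canonical form with its diagonal entries replaced by arbitrary ones. -/
noncomputable def deformation (C : ConsimilarityData) (a : (Σ i : Fin C.r, Fin (C.k i)) → ℂ)
    (b : (Σ i : Fin C.s, Fin (C.l i)) → ℂ) (c : (Σ i : Fin C.u, Fin (C.m i)) → ℂ) :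
    Matrix C.Index C.Index ℂ :=
  Matrix.fromBlocks
    (Matrix.blockDiagonal' fun i => upperBidiagonal fun j => a ⟨i, j⟩) 0 0
    (Matrix.fromBlocks
      (Matrix.blockDiagonal' fun i =>
        Matrix.fromBlocks 0 1 (upperBidiagonal fun j => b ⟨i, j⟩) 0) 0 0
      (Matrix.blockDiagonal' fun i =>
        Matrix.fromBlocks 0 1 (upperBidiagonal fun j => c ⟨i, j⟩) 0))

theorem toMatrix_eq_deformation (C : ConsimilarityData) :
    C.toMatrix = C.deformation (fun p => ((√(C.μ p.1) : ℝ) : ℂ)) (fun p => ((C.ν p.1 : ℝ) : ℂ))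
      (fun p => C.c p.1) := rfl

end ConsimilarityData

/-- The multiset of the values of `a`, of `lam` and of the conjugates of `lam`. -/
noncomputable def conjClosure {X Z : Type*} [Fintype X] [Fintype Z] (a : X → ℝ) (lam : Z → ℂ) :
    Multiset ℂ :=
  (Finset.univ.val.map fun p => (a p : ℂ)) +
    (Finset.univ.val.map lam + Finset.univ.val.map fun p => starRingEnd ℂ (lam p))

theorem ConsimilarityData.consimilaritySpectrum_deformation (C : ConsimilarityData)
    (a : (Σ i : Fin C.r, Fin (C.k i)) → ℝ)
    (b : (Σ i : Fin C.s, Fin (C.l i)) → ℂ) (c : (Σ i : Fin C.u, Fin (C.m i)) → ℂ) :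
    consimilaritySpectrum (C.deformation (fun p => a p) b c) =
      conjClosure (fun p => a p * a p) (Sum.elim b c) := by
  rw [ConsimilarityData.deformation, consimilaritySpectrum_fromBlocks,
    consimilaritySpectrum_fromBlocks, consimilaritySpectrum_blockDiagonal'_upperBidiagonal fun p => (a p : ℂ),
    consimilaritySpectrum_blockDiagonal'_doubled, consimilaritySpectrum_blockDiagonal'_doubled,
    conjClosure]
  congr 1
  · simp
  · rw [← Finset.univ_disjSum_univ, Finset.val_disjSum, Multiset.disjSum, Multiset.map_add,
      Multiset.map_add, Multiset.map_map, Multiset.map_map, Multiset.map_map, Multiset.map_map]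
    simp only [Function.comp_def, Sum.elim_inl, Sum.elim_inr]
    abel

theorem HasCanonicalForm.consimilaritySpectrum_eq {n : ℕ} {A : Matrix (Fin n) (Fin n) ℂ}
    {C : ConsimilarityData} (h : HasCanonicalForm A C) :
    consimilaritySpectrum A = conjClosure (fun p : Σ i : Fin C.r, Fin (C.k i) => C.μ p.1)
      (Sum.elim (fun p : Σ i : Fin C.s, Fin (C.l i) => ((C.ν p.1 : ℝ) : ℂ))
        (fun p : Σ i : Fin C.u, Fin (C.m i) => C.c p.1)) := by
  obtain ⟨e, he⟩ := h
  rw [← he.consimilaritySpectrum_eq, consimilaritySpectrum_reindex, C.toMatrix_eq_deformation,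
    C.consimilaritySpectrum_deformation]
  congr 1
  funext p
  exact Real.mul_self_sqrt (C.μ_pos p.1).le

theorem countP_map_univ {X : Type*} [Fintype X] (f : X → ℂ) (p : ℂ → Prop) [DecidablePred p] :
    ((Finset.univ : Finset X).val.map f).countP p = (Finset.univ.filter fun x => p (f x)).card := by
  rw [Multiset.countP_map]
  rfl

section Count

open Classical in
/-- The numbers of positive, negative and nonreal values of the parameters are determined by the
multiset that they generate. -/
theorem countP_conjClosure {X Y Z : Type*} [Fintype X] [Fintype Y] [Fintype Z] {a : X → ℝ}
    {b : Y → ℂ} {c : Z → ℂ} (ha : ∀ x, 0 < a x) (hb : ∀ y, (b y).im = 0 ∧ (b y).re < 0)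
    (hc : ∀ z, (c z).im ≠ 0) :
    (conjClosure a (Sum.elim b c)).countP (fun w => w.im = 0 ∧ 0 < w.re) = Fintype.card X ∧
    (conjClosure a (Sum.elim b c)).countP (fun w => w.im = 0 ∧ w.re < 0) = 2 * Fintype.card Y ∧
    (conjClosure a (Sum.elim b c)).countP (fun w => w.im ≠ 0) = 2 * Fintype.card Z := by
  have hb1 : ∀ y, ¬ 0 < (b y).re := fun y => not_lt.mpr (hb y).2.le
  have ha1 : ∀ x, ¬ a x < 0 := fun x => not_lt.mpr (ha x).le
  have key : conjClosure a (Sum.elim b c) = (Finset.univ.val.map fun p => (a p : ℂ)) +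
      ((Finset.univ.val.map b + Finset.univ.val.map c) +
        ((Finset.univ.val.map fun p => starRingEnd ℂ (b p)) +
          Finset.univ.val.map fun p => starRingEnd ℂ (c p))) := by
    rw [conjClosure, ← Finset.univ_disjSum_univ, Finset.val_disjSum, Multiset.disjSum,
      Multiset.map_add, Multiset.map_add, Multiset.map_map, Multiset.map_map, Multiset.map_map,
      Multiset.map_map]
    simp only [Function.comp_def, Sum.elim_inl, Sum.elim_inr]
  rw [key]
  simp only [Multiset.countP_add, countP_map_univ, Complex.ofReal_re, Complex.ofReal_im,
    Complex.conj_re, Complex.conj_im, neg_eq_zero, ha, ha1, hb, hb1, hc, ne_eq, not_true_eq_false,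
    not_false_eq_true, and_true, and_false, false_and, Finset.filter_true,
    Finset.filter_false, Finset.card_univ, Finset.card_empty]
  omega

open Classical in
theorem HasCanonicalForm.countP_eq {n : ℕ} {A : Matrix (Fin n) (Fin n) ℂ}
    {C : ConsimilarityData} (h : HasCanonicalForm A C) :
    (consimilaritySpectrum A).countP (fun w => w.im = 0 ∧ 0 < w.re) = C.numPos ∧
    (consimilaritySpectrum A).countP (fun w => w.im = 0 ∧ w.re < 0) = 2 * C.numNeg ∧
    (consimilaritySpectrum A).countP (fun w => w.im ≠ 0) = 2 * C.numNonreal := by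
  rw [h.consimilaritySpectrum_eq]
  have := countP_conjClosure (a := fun p : Σ i : Fin C.r, Fin (C.k i) => C.μ p.1)
    (b := fun p : Σ i : Fin C.s, Fin (C.l i) => ((C.ν p.1 : ℝ) : ℂ))
    (c := fun p : Σ i : Fin C.u, Fin (C.m i) => C.c p.1) (fun p => C.μ_pos p.1)
    (fun p => ⟨Complex.ofReal_im _, C.ν_neg p.1⟩) (fun p => C.c_nonreal p.1)
  simpa only [Fintype.card_sigma, Fintype.card_fin, ConsimilarityData.numPos,
    ConsimilarityData.numNeg, ConsimilarityData.numNonreal] using this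

end Count

/-! ### The set $\mathcal G_n$ in terms of the spectrum. -/

/-- Every element is nonzero, and simple unless it is negative, in which case it may be double. -/
def IsGenericSpectrum (R : Multiset ℂ) : Prop :=
  ∀ z ∈ R, z ≠ 0 ∧ (R.count z ≤ 1 ∨ (z.im = 0 ∧ z.re < 0 ∧ R.count z ≤ 2))

theorem count_map_univ {X : Type*} [Fintype X] (f : X → ℂ) (z : ℂ) :
    ((Finset.univ : Finset X).val.map f).count z = (Finset.univ.filter fun x => z = f x).card := by
  rw [Multiset.count_map]
  rfl

theorem count_conjClosure {X Z : Type*} [Fintype X] [Fintype Z] (a : X → ℝ) (lam : Z → ℂ) (z : ℂ) :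
    (conjClosure a lam).count z = (Finset.univ.filter fun x => z = (a x : ℂ)).card +
      ((Finset.univ.filter fun j => z = lam j).card +
        (Finset.univ.filter fun j => z = starRingEnd ℂ (lam j)).card) := by
  rw [conjClosure, Multiset.count_add, Multiset.count_add, count_map_univ, count_map_univ,
    count_map_univ]

theorem mem_conjClosure {X Z : Type*} [Fintype X] [Fintype Z] {a : X → ℝ} {lam : Z → ℂ} {z : ℂ} :
    z ∈ conjClosure a lam ↔
      (∃ x, (a x : ℂ) = z) ∨ (∃ j, lam j = z) ∨ ∃ j, starRingEnd ℂ (lam j) = z := by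
  simp [conjClosure]

/-- Each of the three families takes a value at most once. A positive value comes only from `a`, a
nonreal one from only one of `lam` and its conjugate, and a negative one may come from both of
these. -/
theorem isGenericSpectrum_conjClosure {X Z : Type*} [Fintype X] [Fintype Z] {a : X → ℝ}
    {lam : Z → ℂ} (ha : ∀ x, 0 < a x)
    (hlam : ∀ j, (lam j).im ≠ 0 ∨ ((lam j).im = 0 ∧ (lam j).re < 0))
    (hainj : Function.Injective a)
    (hdist : ∀ i j, i ≠ j → lam i ≠ lam j ∧ lam i ≠ starRingEnd ℂ (lam j)) :
    IsGenericSpectrum (conjClosure a lam) := by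
  intro z hz
  have h1 : (Finset.univ.filter fun x => z = (a x : ℂ)).card ≤ 1 := by
    rw [Finset.card_le_one]
    intro x hx y hy
    simp only [Finset.mem_filter, Finset.mem_univ, true_and] at hx hy
    exact hainj (Complex.ofReal_injective (hx.symm.trans hy))
  have h2 : (Finset.univ.filter fun j => z = lam j).card ≤ 1 := by
    rw [Finset.card_le_one]
    intro x hx y hy
    simp only [Finset.mem_filter, Finset.mem_univ, true_and] at hx hy
    by_contra hne
    exact (hdist x y hne).1 (hx.symm.trans hy)
  have h3 : (Finset.univ.filter fun j => z = starRingEnd ℂ (lam j)).card ≤ 1 := by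
    rw [Finset.card_le_one]
    intro x hx y hy
    simp only [Finset.mem_filter, Finset.mem_univ, true_and] at hx hy
    by_contra hne
    exact (hdist x y hne).1 ((starRingEnd ℂ).injective (hx.symm.trans hy))
  have hcase : z.im ≠ 0 ∨ (z.im = 0 ∧ (0 < z.re ∨ z.re < 0)) := by
    rcases mem_conjClosure.mp hz with ⟨x, rfl⟩ | ⟨j, rfl⟩ | ⟨j, rfl⟩
    · exact Or.inr ⟨Complex.ofReal_im _, Or.inl (ha x)⟩
    · exact (hlam j).imp_right fun h => ⟨h.1, Or.inr h.2⟩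
    · rw [Complex.conj_im, Complex.conj_re, ne_eq, neg_eq_zero]
      exact (hlam j).imp_right fun h => ⟨h.1, Or.inr h.2⟩
  rw [count_conjClosure]
  rcases hcase with him | ⟨him, hre | hre⟩
  · refine ⟨fun h => him (by rw [h, Complex.zero_im]), Or.inl ?_⟩
    have h4 : (Finset.univ.filter fun x => z = (a x : ℂ)) = ∅ := by
      rw [Finset.filter_eq_empty_iff]
      rintro x _ rfl
      exact him (Complex.ofReal_im _)
    rw [h4, Finset.card_empty, zero_add]
    by_contra! hcon
    obtain ⟨i, hi⟩ := Finset.card_pos.mp (show 0 < (Finset.univ.filter fun j => z = lam j).card by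
      omega)
    obtain ⟨j, hj⟩ := Finset.card_pos.mp
      (show 0 < (Finset.univ.filter fun j => z = starRingEnd ℂ (lam j)).card by omega)
    simp only [Finset.mem_filter, Finset.mem_univ, true_and] at hi hj
    by_cases hij : i = j
    · subst hij
      refine him (Complex.conj_eq_iff_im.mp ?_)
      rw [hj, Complex.conj_conj]
      exact hi.symm.trans hj
    · exact (hdist i j hij).2 (hi.symm.trans hj)
  · refine ⟨fun h => hre.ne' (by rw [h, Complex.zero_re]), Or.inl ?_⟩
    have hne : ∀ j, z ≠ lam j := by
      rintro j rfl
      rcases hlam j with h | h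
      · exact h him
      · exact lt_asymm h.2 hre
    have hne' : ∀ j, z ≠ starRingEnd ℂ (lam j) := by
      rintro j rfl
      refine hne j (Complex.conj_eq_iff_im.mpr ?_)
      simpa using him
    simpa [hne, hne'] using h1
  · refine ⟨fun h => hre.ne (by rw [h, Complex.zero_re]), Or.inr ⟨him, hre, ?_⟩⟩
    have h4 : (Finset.univ.filter fun x => z = (a x : ℂ)) = ∅ := by
      rw [Finset.filter_eq_empty_iff]
      rintro x _ rfl
      exact lt_asymm (ha x) hre
    rw [h4, Finset.card_empty]
    omega

theorem one_lt_card_filter_eq {Y : Type*} [Fintype Y] (f : Y → ℂ) {x y : Y} (hne : x ≠ y)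
    (hf : f x = f y) : 1 < (Finset.univ.filter fun t => f x = f t).card :=
  Finset.one_lt_card.mpr ⟨x, by simp, y, by simp [hf], hne⟩

/-- A coincidence among the `lam` produces a multiple element, which must be negative; being real,
it is then repeated among the conjugates too and has multiplicity at least four. A coincidence with
a conjugate also gives a multiple, hence real, element and so reduces to the former case. -/
theorem distinct_of_isGenericSpectrum {X Z : Type*} [Fintype X] [Fintype Z] {a : X → ℝ}
    {lam : Z → ℂ} (ha : ∀ x, 0 < a x) (h : IsGenericSpectrum (conjClosure a lam)) :
    Function.Injective a ∧ ∀ i j, i ≠ j → lam i ≠ lam j ∧ lam i ≠ starRingEnd ℂ (lam j) := by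
  constructor
  · intro x y hxy
    by_contra hne
    have h1 := one_lt_card_filter_eq (fun t => (a t : ℂ)) hne (by simp [hxy])
    have h2 := count_conjClosure a lam (a x)
    rcases (h (a x) (mem_conjClosure.mpr (Or.inl ⟨x, rfl⟩))).2 with h3 | ⟨-, h3, -⟩
    · omega
    · exact lt_asymm h3 (ha x)
  · have hinj : ∀ i j, i ≠ j → lam i ≠ lam j := by
      intro i j hne heq
      have h1 := one_lt_card_filter_eq lam hne heq
      have h2 := count_conjClosure a lam (lam i)
      rcases (h (lam i) (mem_conjClosure.mpr (Or.inr (Or.inl ⟨i, rfl⟩)))).2 with h3 | ⟨h3, -, h4⟩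
      · omega
      · have h5 := one_lt_card_filter_eq (fun t => starRingEnd ℂ (lam t)) hne (by simp only [heq])
        rw [Complex.conj_eq_iff_im.mpr h3] at h5
        omega
    refine fun i j hne => ⟨hinj i j hne, fun heq => ?_⟩
    have h1 : 0 < (Finset.univ.filter fun t => lam i = lam t).card :=
      Finset.card_pos.mpr ⟨i, by simp⟩
    have h1' : 0 < (Finset.univ.filter fun t => lam i = starRingEnd ℂ (lam t)).card :=
      Finset.card_pos.mpr ⟨j, by simp [heq]⟩
    have h2 := count_conjClosure a lam (lam i)
    rcases (h (lam i) (mem_conjClosure.mpr (Or.inr (Or.inl ⟨i, rfl⟩)))).2 with h3 | ⟨h3, -, -⟩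
    · omega
    · refine hinj i j hne ?_
      rw [← Complex.conj_eq_iff_im.mpr h3, heq, Complex.conj_conj]

/-- The matrix `Λ` of `diagSumBlocks`, with pairs as indices. -/
def antidiagonalBlocks {q : ℕ} (lam : Fin q → ℂ) : Matrix (Fin q × Fin 2) (Fin q × Fin 2) ℂ :=
  Matrix.of fun a b : Fin q × Fin 2 =>
    if a.1 = b.1 then (!![0, 1; lam a.1, 0] : Matrix (Fin 2) (Fin 2) ℂ) a.2 b.2 else 0

theorem diagSumBlocks_eq_reindex {p q : ℕ} (d : Fin p → ℝ) (lam : Fin q → ℂ) :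
    ∃ e : Fin p ⊕ (Fin q × Fin 2) ≃ Fin (p + q * 2), diagSumBlocks d lam =
      Matrix.reindex e e (Matrix.fromBlocks (Matrix.diagonal fun i => ((d i : ℝ) : ℂ)) 0 0
        (antidiagonalBlocks lam)) := by
  refine ⟨(Equiv.sumCongr (Equiv.refl _) finProdFinEquiv).trans finSumFinEquiv, ?_⟩
  have : Matrix.fromBlocks (Matrix.diagonal fun i => ((d i : ℝ) : ℂ)) 0 0
      (Matrix.reindex finProdFinEquiv finProdFinEquiv (antidiagonalBlocks lam)) =
      Matrix.reindex (Equiv.sumCongr (Equiv.refl _) finProdFinEquiv)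
        (Equiv.sumCongr (Equiv.refl _) finProdFinEquiv)
        (Matrix.fromBlocks (Matrix.diagonal fun i => ((d i : ℝ) : ℂ)) 0 0
          (antidiagonalBlocks lam)) := by
    ext (i | i) (j | j) <;> rfl
  rw [diagSumBlocks]
  refine (congrArg (Matrix.reindex finSumFinEquiv finSumFinEquiv) this).trans ?_
  rfl

theorem roots_prod_X_sub_C_univ {ι : Type*} [Fintype ι] (f : ι → ℂ) :
    (∏ i, (X - C (f i))).roots = Finset.univ.val.map f := by
  rw [← roots_multiset_prod_X_sub_C (Finset.univ.val.map f), Multiset.map_map]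
  rfl

theorem consimilaritySpectrum_diagonal {p : ℕ} (d : Fin p → ℝ) :
    consimilaritySpectrum (Matrix.diagonal fun i => ((d i : ℝ) : ℂ)) =
      Finset.univ.val.map fun i => ((d i * d i : ℝ) : ℂ) := by
  have h1 : conjMatrix (Matrix.diagonal fun i => ((d i : ℝ) : ℂ)) =
      Matrix.diagonal fun i => ((d i : ℝ) : ℂ) := by
    rw [conjMatrix, Matrix.diagonal_map (map_zero _)]
    congr 1
    funext i
    simp
  rw [consimilaritySpectrum, h1, Matrix.diagonal_mul_diagonal, Matrix.charpoly_diagonal,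
    roots_prod_X_sub_C_univ]
  simp

theorem consimilaritySpectrum_antidiagonalBlocks {q : ℕ} (lam : Fin q → ℂ) :
    consimilaritySpectrum (antidiagonalBlocks lam) =
      Finset.univ.val.map lam + Finset.univ.val.map fun j => starRingEnd ℂ (lam j) := by
  have h1 : antidiagonalBlocks lam * conjMatrix (antidiagonalBlocks lam) =
      Matrix.diagonal fun p => if p.2 = 0 then starRingEnd ℂ (lam p.1) else lam p.1 := by
    ext ⟨i, t⟩ ⟨j, t'⟩
    rw [Matrix.mul_apply, Fintype.sum_prod_type, Finset.sum_eq_single i]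
    · by_cases hij : i = j
      · subst hij
        fin_cases t <;> fin_cases t' <;>
          simp [antidiagonalBlocks, conjMatrix]
      · have : ((i, t) : Fin q × Fin 2) ≠ (j, t') := fun h => hij (congrArg Prod.fst h)
        simp [antidiagonalBlocks, conjMatrix, hij]
    · intro i' _ hi'
      simp [antidiagonalBlocks, hi'.symm]
    · simp
  rw [consimilaritySpectrum, h1, Matrix.charpoly_diagonal, Fintype.prod_prod_type]
  simp only [Fin.prod_univ_two, if_true, one_ne_zero, if_false]
  rw [Finset.prod_mul_distrib, roots_mul, roots_prod_X_sub_C_univ, roots_prod_X_sub_C_univ,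
    add_comm]
  exact mul_ne_zero (Finset.prod_ne_zero_iff.mpr fun i _ => X_sub_C_ne_zero _)
    (Finset.prod_ne_zero_iff.mpr fun i _ => X_sub_C_ne_zero _)

theorem HasDistinctDiagSumForm.isGenericSpectrum {n : ℕ} {B : Matrix (Fin n) (Fin n) ℂ}
    (h : HasDistinctDiagSumForm B) : IsGenericSpectrum (consimilaritySpectrum B) := by
  obtain ⟨p, q, hn, d, lam, hd, hlam, hinj, hdist, hB⟩ := h
  obtain ⟨e, he⟩ := diagSumBlocks_eq_reindex d lam
  rw [← hB.consimilaritySpectrum_eq, consimilaritySpectrum_reindex, he,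
    consimilaritySpectrum_reindex, consimilaritySpectrum_fromBlocks,
    consimilaritySpectrum_diagonal, consimilaritySpectrum_antidiagonalBlocks]
  refine isGenericSpectrum_conjClosure (a := fun i => d i * d i) (lam := lam)
    (fun i => mul_pos (hd i) (hd i)) hlam (fun i j hij => hinj ?_) hdist
  exact (mul_self_inj (hd i).le (hd j).le).mp hij

theorem Consimilar.trans {ι : Type*} [Fintype ι] [DecidableEq ι] {A B D : Matrix ι ι ℂ}
    (h : Consimilar A B) (h' : Consimilar B D) : Consimilar A D := by
  obtain ⟨S, hS, rfl⟩ := h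
  obtain ⟨R, hR, rfl⟩ := h'
  refine ⟨R * S, by rw [Matrix.det_mul]; exact hR.mul hS, ?_⟩
  rw [conjMatrix_mul, Matrix.mul_inv_rev]
  simp only [mul_assoc]

theorem consimilar_reindex {ι : Type*} [Fintype ι] [DecidableEq ι] (σ : ι ≃ ι) (A : Matrix ι ι ℂ) :
    Consimilar A (Matrix.reindex σ σ A) := by
  have h1 : (1 : Matrix ι ι ℂ).submatrix σ.symm id * (1 : Matrix ι ι ℂ).submatrix id σ.symm = 1 := by
    have := Matrix.submatrix_mul_equiv (1 : Matrix ι ι ℂ) 1 σ.symm (Equiv.refl ι) σ.symm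
    rwa [mul_one, Matrix.submatrix_one_equiv] at this
  have h2 : conjMatrix ((1 : Matrix ι ι ℂ).submatrix σ.symm id) =
      (1 : Matrix ι ι ℂ).submatrix σ.symm id := by
    ext i j
    simp [conjMatrix, Matrix.one_apply, apply_ite]
  refine ⟨(1 : Matrix ι ι ℂ).submatrix σ.symm id, Matrix.isUnit_det_of_right_inverse h1, ?_⟩
  rw [h2, Matrix.inv_eq_right_inv h1]
  ext i j
  simp [Matrix.mul_apply, Matrix.one_apply]

theorem consimilar_reindex_reindex {ι κ : Type*} [Fintype κ] [DecidableEq κ]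
    (e e' : ι ≃ κ) (A : Matrix ι ι ℂ) :
    Consimilar (Matrix.reindex e e A) (Matrix.reindex e' e' A) := by
  have := consimilar_reindex (e.symm.trans e') (Matrix.reindex e e A)
  convert this using 1
  ext i j
  simp

/-- If $\det B = 0$, then $0$ is a root of the characteristic polynomial of $B\bar B$, which
genericity forbids. -/
theorem isUnit_det_of_isGenericSpectrum {n : ℕ} {B : Matrix (Fin n) (Fin n) ℂ}
    (h : IsGenericSpectrum (consimilaritySpectrum B)) : IsUnit B.det := by
  rw [isUnit_iff_ne_zero]
  intro h0
  have h1 : (B * conjMatrix B).charpoly.coeff 0 = 0 := by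
    have := Matrix.det_eq_sign_charpoly_coeff (B * conjMatrix B)
    rw [Matrix.det_mul, h0, zero_mul] at this
    exact (mul_eq_zero.mp this.symm).resolve_left (pow_ne_zero _ (by norm_num))
  refine (h 0 ?_).1 rfl
  rw [consimilaritySpectrum, mem_roots (Matrix.charpoly_monic _).ne_zero, IsRoot.def,
    ← coeff_zero_eq_eval_zero, h1]

namespace ConsimilarityData

/-- The position of a block of size one in the form `D ⊕ Λ`. -/
def toDiagSumIndex (C : ConsimilarityData) : C.Index → Fin C.r ⊕ (Fin (C.s + C.u) × Fin 2)
  | Sum.inl p => Sum.inl p.1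
  | Sum.inr (Sum.inl ⟨i, Sum.inl _⟩) => Sum.inr (Fin.castAdd C.u i, 0)
  | Sum.inr (Sum.inl ⟨i, Sum.inr _⟩) => Sum.inr (Fin.castAdd C.u i, 1)
  | Sum.inr (Sum.inr ⟨i, Sum.inl _⟩) => Sum.inr (Fin.natAdd C.s i, 0)
  | Sum.inr (Sum.inr ⟨i, Sum.inr _⟩) => Sum.inr (Fin.natAdd C.s i, 1)

/-- The values `ν` and `c` in a row. -/
noncomputable def lam (C : ConsimilarityData) : Fin (C.s + C.u) → ℂ :=
  Fin.append (fun i => ((C.ν i : ℝ) : ℂ)) C.c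

theorem toDiagSumIndex_bijective (C : ConsimilarityData) (hk : ∀ i, Subsingleton (Fin (C.k i)))
    (hl : ∀ i, Subsingleton (Fin (C.l i))) (hm : ∀ i, Subsingleton (Fin (C.m i))) :
    Function.Bijective C.toDiagSumIndex := by
  have hcn : ∀ (i : Fin C.s) (j : Fin C.u), Fin.castAdd C.u i ≠ Fin.natAdd C.s j := by
    intro i j h
    have := congrArg Fin.val h
    simp only [Fin.val_castAdd, Fin.val_natAdd] at this
    omega
  constructor
  · rintro (⟨i, j⟩ | ⟨i, j | j⟩ | ⟨i, j | j⟩) (⟨i', j'⟩ | ⟨i', j' | j'⟩ | ⟨i', j' | j'⟩) h <;>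
      simp only [toDiagSumIndex, Sum.inl.injEq, Sum.inr.injEq, Prod.mk.injEq, reduceCtorEq,
        Fin.castAdd_inj, Fin.natAdd_inj, hcn, (hcn _ _).symm, zero_ne_one, one_ne_zero, and_false,
        and_true] at h
    all_goals
      subst h
      obtain rfl : j = j' := Subsingleton.elim _ _
      rfl
  · rintro (i | ⟨i, t⟩)
    · exact ⟨Sum.inl ⟨i, ⟨0, C.k_pos i⟩⟩, rfl⟩
    · refine Fin.addCases (fun i => ?_) (fun i => ?_) i
      · fin_cases t
        · exact ⟨Sum.inr (Sum.inl ⟨i, Sum.inl ⟨0, C.l_pos i⟩⟩), rfl⟩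
        · exact ⟨Sum.inr (Sum.inl ⟨i, Sum.inr ⟨0, C.l_pos i⟩⟩), rfl⟩
      · fin_cases t
        · exact ⟨Sum.inr (Sum.inr ⟨i, Sum.inl ⟨0, C.m_pos i⟩⟩), rfl⟩
        · exact ⟨Sum.inr (Sum.inr ⟨i, Sum.inr ⟨0, C.m_pos i⟩⟩), rfl⟩

theorem toMatrix_apply_eq (C : ConsimilarityData) (hk : ∀ i, Subsingleton (Fin (C.k i)))
    (hl : ∀ i, Subsingleton (Fin (C.l i))) (hm : ∀ i, Subsingleton (Fin (C.m i)))
    (x y : C.Index) :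
    C.toMatrix x y = Matrix.fromBlocks (Matrix.diagonal fun i => ((√(C.μ i) : ℝ) : ℂ)) 0 0
      (antidiagonalBlocks C.lam) (C.toDiagSumIndex x) (C.toDiagSumIndex y) := by
  have hcn : ∀ (i : Fin C.s) (j : Fin C.u), Fin.castAdd C.u i ≠ Fin.natAdd C.s j := by
    intro i j h
    have := congrArg Fin.val h
    simp only [Fin.val_castAdd, Fin.val_natAdd] at this
    omega
  rcases x with ⟨i, j⟩ | ⟨i, j | j⟩ | ⟨i, j | j⟩ <;>
  rcases y with ⟨i', j'⟩ | ⟨i', j' | j'⟩ | ⟨i', j' | j'⟩ <;>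
  simp only [toMatrix, toDiagSumIndex, Matrix.fromBlocks_apply₁₁, Matrix.fromBlocks_apply₂₁,
      Matrix.fromBlocks_apply₁₂, Matrix.fromBlocks_apply₂₂, Matrix.zero_apply, antidiagonalBlocks,
      Matrix.of_apply, hcn, (hcn _ _).symm, if_false, Fin.castAdd_inj, Fin.natAdd_inj]
  all_goals
    by_cases hi : i = i'
    · subst hi
      obtain rfl : j = j' := Subsingleton.elim _ _
      simp [Matrix.blockDiagonal'_apply_eq, doubledJordanBlock, jordanBlock, lam]
    · simp [Matrix.blockDiagonal'_apply_ne _ _ _ hi, hi]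

end ConsimilarityData

/-- A block of size above one would repeat its parameter in the spectrum, so all blocks of the
canonical form have size one, and that form is $D \oplus \Lambda$ up to a permutation. -/
theorem hasDistinctDiagSumForm_of_isGenericSpectrum {n : ℕ} {B : Matrix (Fin n) (Fin n) ℂ}
    (h : IsGenericSpectrum (consimilaritySpectrum B)) : HasDistinctDiagSumForm B := by
  obtain ⟨C, hC⟩ := exists_hasCanonicalForm B (isUnit_det_of_isGenericSpectrum h)
  rw [hC.consimilaritySpectrum_eq] at h
  obtain ⟨ha, hlam⟩ := distinct_of_isGenericSpectrum
    (a := fun p : Σ i : Fin C.r, Fin (C.k i) => C.μ p.1) (fun p => C.μ_pos p.1) h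
  have hlam' : ∀ i j, Sum.elim (fun p : Σ i : Fin C.s, Fin (C.l i) => ((C.ν p.1 : ℝ) : ℂ))
        (fun p : Σ i : Fin C.u, Fin (C.m i) => C.c p.1) i =
      Sum.elim (fun p : Σ i : Fin C.s, Fin (C.l i) => ((C.ν p.1 : ℝ) : ℂ))
        (fun p : Σ i : Fin C.u, Fin (C.m i) => C.c p.1) j → i = j :=
    fun i j hij => by_contra fun hne => (hlam i j hne).1 hij
  have hk : ∀ i, Subsingleton (Fin (C.k i)) := fun i => ⟨fun j j' => by
    have := @ha ⟨i, j⟩ ⟨i, j'⟩ rfl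
    simpa using this⟩
  have hl : ∀ i, Subsingleton (Fin (C.l i)) := fun i => ⟨fun j j' => by
    have := hlam' (Sum.inl ⟨i, j⟩) (Sum.inl ⟨i, j'⟩) rfl
    simpa using this⟩
  have hm : ∀ i, Subsingleton (Fin (C.m i)) := fun i => ⟨fun j j' => by
    have := hlam' (Sum.inr ⟨i, j⟩) (Sum.inr ⟨i, j'⟩) rfl
    simpa using this⟩
  obtain ⟨e, he⟩ := hC
  let g := Equiv.ofBijective _ (C.toDiagSumIndex_bijective hk hl hm)
  obtain ⟨E, hE⟩ := diagSumBlocks_eq_reindex (fun i => √(C.μ i)) C.lam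
  have hn : C.r + (C.s + C.u) * 2 = n := by
    simpa using Fintype.card_congr ((g.symm.trans e).symm.trans E).symm
  let f : Fin (C.s + C.u) → (Σ i : Fin C.s, Fin (C.l i)) ⊕ (Σ i : Fin C.u, Fin (C.m i)) :=
    Fin.addCases (fun i => Sum.inl ⟨i, ⟨0, C.l_pos i⟩⟩) (fun i => Sum.inr ⟨i, ⟨0, C.m_pos i⟩⟩)
  have hf : ∀ j, C.lam j = Sum.elim (fun p : Σ i : Fin C.s, Fin (C.l i) => ((C.ν p.1 : ℝ) : ℂ))
        (fun p : Σ i : Fin C.u, Fin (C.m i) => C.c p.1) (f j) := by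
    intro j
    refine Fin.addCases (fun i => ?_) (fun i => ?_) j <;> simp [f, ConsimilarityData.lam]
  have hfinj : Function.Injective f := by
    intro i j
    refine Fin.addCases (fun i => ?_) (fun i => ?_) i <;>
    refine Fin.addCases (fun j => ?_) (fun j => ?_) j <;> intro hij <;> simp [f] at hij
    · rw [hij.1]
    · rw [hij.1]
  refine ⟨C.r, C.s + C.u, hn, fun i => √(C.μ i), C.lam, fun i => Real.sqrt_pos.mpr (C.μ_pos i),
    ?_, ?_, ?_, ?_⟩
  · intro j
    refine Fin.addCases (fun i => ?_) (fun i => ?_) j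
    · right
      simpa [ConsimilarityData.lam] using C.ν_neg i
    · left
      simpa [ConsimilarityData.lam] using C.c_nonreal i
  · intro i j hij
    have h1 : C.μ i = C.μ j := (Real.sqrt_inj (C.μ_pos i).le (C.μ_pos j).le).mp hij
    exact congrArg Sigma.fst (@ha ⟨i, ⟨0, C.k_pos i⟩⟩ ⟨j, ⟨0, C.k_pos j⟩⟩ h1)
  · intro i j hne
    rw [hf, hf]
    exact hlam _ _ (hfinj.ne hne)
  · refine he.trans ?_
    have h1 : C.toMatrix = Matrix.reindex g.symm g.symm
        (Matrix.fromBlocks (Matrix.diagonal fun i => ((√(C.μ i) : ℝ) : ℂ)) 0 0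
          (antidiagonalBlocks C.lam)) := by
      ext x y
      exact C.toMatrix_apply_eq hk hl hm x y
    rw [hE, h1]
    exact consimilar_reindex_reindex (g.symm.trans e) (E.trans (finCongr hn)) _

theorem hasDistinctDiagSumForm_iff {n : ℕ} {B : Matrix (Fin n) (Fin n) ℂ} :
    HasDistinctDiagSumForm B ↔ IsGenericSpectrum (consimilaritySpectrum B) :=
  ⟨HasDistinctDiagSumForm.isGenericSpectrum, hasDistinctDiagSumForm_of_isGenericSpectrum⟩

end

/-! ### Generic perturbations of a canonical form. -/

section

open Filter Topology

/-- Comparing real parts leaves a single possible time of coincidence; if it is zero, it is excluded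
by $t > 0$. -/
theorem eventually_sub_mul_ne (u v : ℂ) {a b : ℝ} (hab : a ≠ b) :
    ∀ᶠ t : ℝ in 𝓝[>] 0, u - (t * a : ℝ) ≠ v - (t * b : ℝ) := by
  have hne : ∀ᶠ t : ℝ in 𝓝[>] 0, t ≠ (u.re - v.re) / (a - b) := by
    by_cases h0 : (u.re - v.re) / (a - b) = 0
    · rw [h0]
      filter_upwards [self_mem_nhdsWithin] with t ht using ne_of_gt ht
    · exact nhdsWithin_le_nhds (eventually_ne_nhds (Ne.symm h0))
  filter_upwards [hne] with t ht heq
  apply ht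
  have h1 := congrArg Complex.re heq
  simp only [Complex.sub_re, Complex.ofReal_re] at h1
  rw [eq_div_iff (sub_ne_zero.mpr hab)]
  linarith

theorem continuous_upperBidiagonal {X : Type*} [TopologicalSpace X] {k : ℕ} {d : X → Fin k → ℂ}
    (hd : ∀ i, Continuous fun x => d x i) : Continuous fun x => upperBidiagonal (d x) := by
  refine continuous_matrix fun i j => ?_
  simp only [upperBidiagonal, Matrix.of_apply]
  split_ifs
  · exact hd i
  · exact continuous_const
  · exact continuous_const

namespace ConsimilarityData

theorem continuous_deformation (C : ConsimilarityData) {X : Type*} [TopologicalSpace X]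
    {a : X → (Σ i : Fin C.r, Fin (C.k i)) → ℂ} {b : X → (Σ i : Fin C.s, Fin (C.l i)) → ℂ}
    {c : X → (Σ i : Fin C.u, Fin (C.m i)) → ℂ} (ha : ∀ p, Continuous fun x => a x p)
    (hb : ∀ p, Continuous fun x => b x p) (hc : ∀ p, Continuous fun x => c x p) :
    Continuous fun x => C.deformation (a x) (b x) (c x) := by
  refine Continuous.matrix_fromBlocks ?_ continuous_const continuous_const
    (Continuous.matrix_fromBlocks ?_ continuous_const continuous_const ?_)
  · exact Continuous.matrix_blockDiagonal'
      (continuous_pi fun i => continuous_upperBidiagonal fun j => ha ⟨i, j⟩)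
  · exact Continuous.matrix_blockDiagonal' (continuous_pi fun i =>
      Continuous.matrix_fromBlocks continuous_const continuous_const
        (continuous_upperBidiagonal fun j => hb ⟨i, j⟩) continuous_const)
  · exact Continuous.matrix_blockDiagonal' (continuous_pi fun i =>
      Continuous.matrix_fromBlocks continuous_const continuous_const
        (continuous_upperBidiagonal fun j => hc ⟨i, j⟩) continuous_const)

open Classical in
/-- A continuous deformation of the canonical form, generic for small positive times, that does
not change the numbers of entries of the three types. -/
theorem exists_generic_deformation (C : ConsimilarityData) :
    ∃ M : ℝ → Matrix C.Index C.Index ℂ, Continuous M ∧ M 0 = C.toMatrix ∧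
      ∀ᶠ t in 𝓝[>] 0, IsGenericSpectrum (consimilaritySpectrum (M t)) ∧
        (consimilaritySpectrum (M t)).countP (fun w => w.im = 0 ∧ 0 < w.re) = C.numPos ∧
        (consimilaritySpectrum (M t)).countP (fun w => w.im = 0 ∧ w.re < 0) = 2 * C.numNeg ∧
        (consimilaritySpectrum (M t)).countP (fun w => w.im ≠ 0) = 2 * C.numNonreal := by
  let X := Σ i : Fin C.r, Fin (C.k i)
  let Y := Σ i : Fin C.s, Fin (C.l i)
  let Z := Σ i : Fin C.u, Fin (C.m i)
  let f : X → ℝ := fun x => ((Fintype.equivFin X x : ℕ) : ℝ)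
  let g : Y ⊕ Z → ℝ := fun x => ((Fintype.equivFin (Y ⊕ Z) x : ℕ) : ℝ)
  have hf : Function.Injective f := fun x y h =>
    (Fintype.equivFin X).injective (Fin.ext (Nat.cast_injective h))
  have hg : Function.Injective g := fun x y h =>
    (Fintype.equivFin (Y ⊕ Z)).injective (Fin.ext (Nat.cast_injective h))
  have hf0 : ∀ x, 0 ≤ f x := fun x => Nat.cast_nonneg _
  have hg0 : ∀ x, 0 ≤ g x := fun x => Nat.cast_nonneg _
  -- Positive parameters move up and negative ones down, preserving signs. All shifts are real, so
  -- nonreal parameters keep their imaginary parts and conjugation does not alter the shifts.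
  let a : ℝ → X → ℝ := fun t x => √(C.μ x.1) + t * f x
  let b : ℝ → Y → ℂ := fun t y => ((C.ν y.1 : ℝ) : ℂ) - (t * g (Sum.inl y) : ℝ)
  let c : ℝ → Z → ℂ := fun t z => C.c z.1 - (t * g (Sum.inr z) : ℝ)
  let lam : Y ⊕ Z → ℂ := Sum.elim (fun y => ((C.ν y.1 : ℝ) : ℂ)) (fun z => C.c z.1)
  have hlam : ∀ t x, Sum.elim (b t) (c t) x = lam x - (t * g x : ℝ) := by
    rintro t (y | z) <;> rfl
  refine ⟨fun t => C.deformation (fun x => a t x) (b t) (c t), ?_, ?_, ?_⟩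
  · refine C.continuous_deformation (fun x => ?_) (fun x => ?_) (fun x => ?_) <;>
      simp only [a, b, c] <;> fun_prop
  · simp only [a, b, c, zero_mul, add_zero, Complex.ofReal_zero, sub_zero]
    rfl
  · have h1 : ∀ᶠ t : ℝ in 𝓝[>] 0, ∀ i j : X, i ≠ j → a t i ≠ a t j := by
      refine eventually_all.mpr fun i => eventually_all.mpr fun j => ?_
      by_cases hij : i = j
      · simp [hij]
      · filter_upwards [eventually_sub_mul_ne ((√(C.μ i.1) : ℝ) : ℂ) ((√(C.μ j.1) : ℝ) : ℂ)
          (a := -f i) (b := -f j) (fun h => hij (hf (neg_injective h)))] with t ht _ heq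
        apply ht
        rw [← Complex.ofReal_sub, ← Complex.ofReal_sub]
        congr 1
        simpa [a] using heq
    have h2 : ∀ᶠ t : ℝ in 𝓝[>] 0, ∀ i j : Y ⊕ Z, i ≠ j →
        Sum.elim (b t) (c t) i ≠ Sum.elim (b t) (c t) j ∧
        Sum.elim (b t) (c t) i ≠ starRingEnd ℂ (Sum.elim (b t) (c t) j) := by
      refine eventually_all.mpr fun i => eventually_all.mpr fun j => ?_
      by_cases hij : i = j
      · simp [hij]
      · filter_upwards [eventually_sub_mul_ne (lam i) (lam j) (hg.ne hij),
          eventually_sub_mul_ne (lam i) (starRingEnd ℂ (lam j)) (hg.ne hij)] with t ht ht' _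
        rw [hlam, hlam, map_sub, Complex.conj_ofReal]
        exact ⟨ht, ht'⟩
    filter_upwards [h1, h2, self_mem_nhdsWithin] with t ht1 ht2 ht0
    have ht0' : (0 : ℝ) < t := ht0
    have ha : ∀ x, 0 < a t x := fun x =>
      add_pos_of_pos_of_nonneg (Real.sqrt_pos.mpr (C.μ_pos x.1)) (mul_nonneg ht0'.le (hf0 x))
    have haa : ∀ x, 0 < a t x * a t x := fun x => mul_pos (ha x) (ha x)
    have hb : ∀ y, (b t y).im = 0 ∧ (b t y).re < 0 := by
      intro y
      have h3 := C.ν_neg y.1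
      have h4 := mul_nonneg ht0'.le (hg0 (Sum.inl y))
      constructor
      · simp only [b, Complex.sub_im, Complex.ofReal_im, sub_zero]
      · simp only [b, Complex.sub_re, Complex.ofReal_re]
        linarith
    have hc : ∀ z, (c t z).im ≠ 0 := by
      intro z
      simpa only [c, Complex.sub_im, Complex.ofReal_im, sub_zero] using C.c_nonreal z.1
    have hcount := countP_conjClosure haa hb hc
    rw [C.consimilaritySpectrum_deformation (a t)]
    refine ⟨isGenericSpectrum_conjClosure haa ?_ ?_ ht2, ?_⟩
    · rintro (y | z)
      · exact Or.inr (hb y)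
      · exact Or.inl (hc z)
    · intro x y hxy
      by_contra hne
      exact ht1 x y hne ((mul_self_inj (ha x).le (ha y).le).mp hxy)
    · simpa only [X, Y, Z, Fintype.card_sigma, Fintype.card_fin, numPos, numNeg, numNonreal]
        using hcount

end ConsimilarityData

/-- Arbitrarily close to a nonsingular matrix there is a generic one with the same numbers of
entries of the three types in its canonical forms. -/
theorem exists_generic_near {n : ℕ} (A : Matrix (Fin n) (Fin n) ℂ) (hA : IsUnit A.det) {ε : ℝ}
    (hε : 0 < ε) :
    ∃ A' : Matrix (Fin n) (Fin n) ℂ, (∀ i j, ‖A' i j - A i j‖ < ε) ∧ HasDistinctDiagSumForm A' ∧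
      ∀ C C' : ConsimilarityData, HasCanonicalForm A C → HasCanonicalForm A' C' →
        C'.numPos = C.numPos ∧ C'.numNeg = C.numNeg ∧ C'.numNonreal = C.numNonreal := by
  obtain ⟨C₀, hC₀⟩ := exists_hasCanonicalForm A hA
  obtain ⟨e, S, hS, hAS⟩ := id hC₀
  obtain ⟨M, hM, hM0, hgen⟩ := C₀.exists_generic_deformation
  have hSc : (conjMatrix S)⁻¹ * conjMatrix S = 1 := by
    rw [conjMatrix_inv hS, ← conjMatrix_mul, Matrix.nonsing_inv_mul _ hS, conjMatrix_one]
  have hSc' : conjMatrix S * (conjMatrix S)⁻¹ = 1 := by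
    rw [conjMatrix_inv hS, ← conjMatrix_mul, Matrix.mul_nonsing_inv _ hS, conjMatrix_one]
  -- The deformation is carried back to `A` by the fixed consimilarity, so it starts at `A` and
  -- keeps the spectrum of `M t`.
  let F : ℝ → Matrix (Fin n) (Fin n) ℂ := fun t =>
    S⁻¹ * Matrix.reindex e e (M t) * conjMatrix S
  have hF : Continuous F :=
    ((continuous_const.matrix_mul (hM.matrix_submatrix _ _)).matrix_mul continuous_const)
  have hF0 : F 0 = A := by
    simp only [F, hM0, ← hAS]
    calc S⁻¹ * (S * A * (conjMatrix S)⁻¹) * conjMatrix S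
        = (S⁻¹ * S) * A * ((conjMatrix S)⁻¹ * conjMatrix S) := by simp only [mul_assoc]
      _ = A := by rw [hSc, Matrix.nonsing_inv_mul _ hS, one_mul, mul_one]
  have hFM : ∀ t, Consimilar (F t) (Matrix.reindex e e (M t)) := by
    intro t
    refine ⟨S, hS, ?_⟩
    calc S * (S⁻¹ * Matrix.reindex e e (M t) * conjMatrix S) * (conjMatrix S)⁻¹
        = (S * S⁻¹) * Matrix.reindex e e (M t) * (conjMatrix S * (conjMatrix S)⁻¹) := by
          simp only [mul_assoc]
      _ = _ := by rw [hSc', Matrix.mul_nonsing_inv _ hS, one_mul, mul_one]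
  have hspec : ∀ t, consimilaritySpectrum (F t) = consimilaritySpectrum (M t) := fun t => by
    rw [← (hFM t).consimilaritySpectrum_eq, consimilaritySpectrum_reindex]
  have hnear : ∀ᶠ t in 𝓝[>] (0 : ℝ), ∀ i j, ‖F t i j - A i j‖ < ε := by
    refine nhdsWithin_le_nhds (eventually_all.mpr fun i => eventually_all.mpr fun j => ?_)
    have h1 : Continuous fun t => ‖F t i j - A i j‖ :=
      ((hF.matrix_elem i j).sub continuous_const).norm
    exact h1.continuousAt.eventually_lt continuousAt_const (by simpa [hF0] using hε)
  obtain ⟨t, hgent, hneart⟩ := (hgen.and hnear).exists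
  rw [← hspec] at hgent
  refine ⟨F t, hneart, hasDistinctDiagSumForm_of_isGenericSpectrum hgent.1,
    fun C C' hC hC' => ?_⟩
  have h1 := hC₀.countP_eq
  have h2 := hC.countP_eq
  have h3 := hC'.countP_eq
  have h4 := hgent.2
  omega

/-! ### Openness: genericity as the complement of a closed condition. -/

section DividedDifference

open Polynomial

/-- The divided difference `(q(z) - q(w)) / (z - w)` of a polynomial of degree less than `N`. -/
noncomputable def dividedDifference (N : ℕ) (q : ℂ[X]) (z w : ℂ) : ℂ :=
  ∑ i ∈ Finset.range N, q.coeff i * ∑ j ∈ Finset.range i, z ^ j * w ^ (i - 1 - j)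

theorem dividedDifference_mul {N : ℕ} {q : ℂ[X]} (hq : q.natDegree < N) (z w : ℂ) :
    dividedDifference N q z w * (z - w) = q.eval z - q.eval w := by
  rw [dividedDifference, Finset.sum_mul, eval_eq_sum_range' hq, eval_eq_sum_range' hq,
    ← Finset.sum_sub_distrib]
  refine Finset.sum_congr rfl fun i _ => ?_
  rw [mul_assoc, (Commute.all z w).geom_sum₂_mul, mul_sub]

theorem dividedDifference_self {N : ℕ} {q : ℂ[X]} (hq : q.natDegree < N) (z : ℂ) :
    dividedDifference N q z z = (derivative q).eval z := by
  rw [dividedDifference, derivative_eval, sum_over_range' _ (by simp) N hq]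
  refine Finset.sum_congr rfl fun i _ => ?_
  rw [geom_sum₂_self, mul_assoc]

/-- The forbidden roots are zero, multiple roots that are positive or nonreal, and negative roots of
multiplicity above two. The divided difference of $p'$ unites the last two in a form that stays
closed as a nonreal root tends to the real axis. -/
theorem isGenericSpectrum_roots_iff {p : ℂ[X]} (hp : p ≠ 0) (hconj : p.map (starRingEnd ℂ) = p)
    {N : ℕ} (hN : p.natDegree < N) :
    IsGenericSpectrum p.roots ↔ ¬ ∃ z, p.eval z = 0 ∧
      (z = 0 ∨ ((derivative p).eval z = 0 ∧
        ((z.im = 0 ∧ 0 ≤ z.re) ∨ dividedDifference N (derivative p) z (starRingEnd ℂ z) = 0))) := by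
  have hN' : (derivative p).natDegree < N := (natDegree_derivative_le p).trans_lt (by omega)
  have hconj' : ∀ z, (derivative p).eval (starRingEnd ℂ z) =
      starRingEnd ℂ ((derivative p).eval z) := by
    intro z
    rw [← eval_map_apply, ← derivative_map, hconj]
  have h1 : ∀ z, 1 < p.roots.count z ↔ p.eval z = 0 ∧ (derivative p).eval z = 0 := by
    intro z
    rw [count_roots, one_lt_rootMultiplicity_iff_isRoot hp, IsRoot.def, IsRoot.def]
  have h2 : ∀ z, 2 < p.roots.count z ↔ p.eval z = 0 ∧ (derivative p).eval z = 0 ∧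
      (derivative (derivative p)).eval z = 0 := by
    intro z
    rw [count_roots, lt_rootMultiplicity_iff_isRoot_iterate_derivative hp]
    constructor
    · intro h
      exact ⟨h 0 (by norm_num), h 1 (by norm_num), h 2 le_rfl⟩
    · rintro ⟨ha, hb, hc⟩ m hm
      interval_cases m
      · exact ha
      · exact hb
      · exact hc
  constructor
  · rintro h ⟨z, hz, hbad⟩
    obtain ⟨hz0, hcount⟩ := h z ((mem_roots hp).mpr hz)
    rcases hbad with rfl | ⟨hd, hbad⟩
    · exact hz0 rfl
    have hc1 : 1 < p.roots.count z := (h1 z).mpr ⟨hz, hd⟩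
    rcases hcount with hcount | ⟨him, hre, hcount⟩
    · omega
    rcases hbad with ⟨-, hre'⟩ | hdd
    · exact absurd hre (not_lt.mpr hre')
    · rw [Complex.conj_eq_iff_im.mpr him, dividedDifference_self hN'] at hdd
      have := (h2 z).mpr ⟨hz, hd, hdd⟩
      omega
  · intro h z hz
    have hz' : p.eval z = 0 := (mem_roots hp).mp hz
    refine ⟨fun h0 => h ⟨z, hz', Or.inl h0⟩, ?_⟩
    by_contra! hcon
    obtain ⟨hc1, hc2⟩ := hcon
    have hd := ((h1 z).mp hc1).2
    refine h ⟨z, hz', Or.inr ⟨hd, ?_⟩⟩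
    by_cases him : z.im = 0
    · rcases le_or_gt 0 z.re with hre | hre
      · exact Or.inl ⟨him, hre⟩
      · right
        rw [Complex.conj_eq_iff_im.mpr him, dividedDifference_self hN']
        exact ((h2 z).mp (hc2 him hre)).2.2
    · right
      -- Since `p` is real, $p'$ vanishes at both $z$ and $\bar z \neq z$, so its divided difference
      -- there is zero.
      have h3 := dividedDifference_mul hN' z (starRingEnd ℂ z)
      rw [hconj', hd, map_zero, sub_zero] at h3
      refine (mul_eq_zero.mp h3).resolve_right fun h4 => him ?_
      exact Complex.conj_eq_iff_im.mp (sub_eq_zero.mp h4).symm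

end DividedDifference

/-- The projection of a closed set with locally bounded fibres is closed. -/
theorem isClosed_exists_of_bound {X : Type*} [TopologicalSpace X] {P : X → ℂ → Prop}
    (hP : IsClosed {x : X × ℂ | P x.1 x.2}) (R : X → ℝ) (hR : Continuous R)
    (hbound : ∀ x z, P x z → ‖z‖ ≤ R x) : IsClosed {x | ∃ z, P x z} := by
  have hcompact : CompactSpace (Metric.closedBall (0 : ℂ) 1) :=
    isCompact_iff_compactSpace.mp (isCompact_closedBall 0 1)
  -- Writing $z = R(x)w$ with $w$ in the unit ball replaces the varying bound by a fixed compact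
  -- factor, along which projection is a closed map.
  let F : X × Metric.closedBall (0 : ℂ) 1 → X × ℂ := fun y => (y.1, (R y.1 : ℂ) * y.2)
  have hF : Continuous F := by
    refine continuous_fst.prodMk ?_
    exact (Complex.continuous_ofReal.comp (hR.comp continuous_fst)).mul
      (continuous_subtype_val.comp continuous_snd)
  have h1 := isClosedMap_fst_of_compactSpace _ (hP.preimage hF)
  convert h1 using 1
  ext x
  constructor
  · rintro ⟨z, hz⟩
    have hz' := hbound x z hz
    have hR0 : 0 ≤ R x := (norm_nonneg z).trans hz'
    have hw : ‖z / (R x : ℂ)‖ ≤ 1 := by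
      rw [norm_div, Complex.norm_real, Real.norm_of_nonneg hR0]
      exact div_le_one_of_le₀ hz' hR0
    refine ⟨(x, ⟨z / (R x : ℂ), by simpa using hw⟩), ?_, rfl⟩
    have : (R x : ℂ) * (z / (R x : ℂ)) = z := by
      by_cases h0 : R x = 0
      · rw [h0] at hz'
        have : z = 0 := norm_le_zero_iff.mp hz'
        simp [this]
      · exact mul_div_cancel₀ z (Complex.ofReal_ne_zero.mpr h0)
    simpa [F, this] using hz
  · rintro ⟨⟨y, w⟩, hy, rfl⟩
    exact ⟨_, hy⟩

/-- Gershgorin's theorem, with the row bound enlarged to a sum over all entries so that it is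
continuous in `M`. -/
theorem norm_le_sum_of_isRoot_charpoly {n : ℕ} (M : Matrix (Fin n) (Fin n) ℂ) {z : ℂ}
    (hz : M.charpoly.eval z = 0) : ‖z‖ ≤ ∑ i, ∑ j, ‖M i j‖ := by
  have hev : Module.End.HasEigenvalue (Matrix.toLin' M) z := by
    rw [Module.End.hasEigenvalue_iff_isRoot_charpoly, Matrix.charpoly_toLin']
    exact hz
  obtain ⟨k, hk⟩ := eigenvalue_mem_ball hev
  rw [Metric.mem_closedBall, dist_eq_norm] at hk
  calc ‖z‖ ≤ ‖M k k‖ + ‖z - M k k‖ := by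
        simpa using norm_add_le (M k k) (z - M k k)
    _ ≤ ‖M k k‖ + ∑ j ∈ Finset.univ.erase k, ‖M k j‖ := by gcongr
    _ = ∑ j, ‖M k j‖ := Finset.add_sum_erase _ (fun j => ‖M k j‖) (Finset.mem_univ k)
    _ ≤ ∑ i, ∑ j, ‖M i j‖ := Finset.single_le_sum (f := fun i => ∑ j, ‖M i j‖)
        (fun i _ => Finset.sum_nonneg fun j _ => norm_nonneg _) (Finset.mem_univ k)

theorem continuous_charpoly_coeff {n : ℕ} (i : ℕ) :
    Continuous fun M : Matrix (Fin n) (Fin n) ℂ => M.charpoly.coeff i := by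
  have h1 : ∀ M : Matrix (Fin n) (Fin n) ℂ, M.charpoly.coeff i =
      MvPolynomial.eval (fun p : Fin n × Fin n => M p.1 p.2)
        ((Matrix.charpoly.univ ℂ (Fin n)).coeff i) := fun M =>
    (Matrix.charpoly.univ_coeff_eval₂Hom (Fin n) (RingHom.id ℂ)
      (fun p : Fin n × Fin n => M p.1 p.2) i).symm
  simp only [h1]
  exact (MvPolynomial.continuous_eval _).comp
    (continuous_pi fun p => continuous_id.matrix_elem p.1 p.2)

theorem continuous_polynomial_eval {X : Type*} [TopologicalSpace X] {q : X → Polynomial ℂ} {N : ℕ}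
    (hN : ∀ x, (q x).natDegree < N) (hq : ∀ i, Continuous fun x => (q x).coeff i) :
    Continuous fun y : X × ℂ => (q y.1).eval y.2 := by
  simp only [fun y : X × ℂ => Polynomial.eval_eq_sum_range' (hN y.1) y.2]
  exact continuous_finsetSum _ fun i _ =>
    ((hq i).comp continuous_fst).mul (continuous_snd.pow i)

/-- The conjugate of $B\bar B$ is $\bar B B$, which has the same characteristic polynomial; so that
polynomial is real. -/
theorem map_charpoly_mul_conjMatrix {n : ℕ} (B : Matrix (Fin n) (Fin n) ℂ) :
    (B * conjMatrix B).charpoly.map (starRingEnd ℂ) = (B * conjMatrix B).charpoly := by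
  rw [← Matrix.charpoly_map]
  have : (B * conjMatrix B).map (starRingEnd ℂ) = conjMatrix B * B := by
    have := conjMatrix_mul B (conjMatrix B)
    rwa [conjMatrix_conjMatrix] at this
  rw [this, Matrix.charpoly_mul_comm]

theorem continuous_mul_conjMatrix {n : ℕ} :
    Continuous fun B : Matrix (Fin n) (Fin n) ℂ => B * conjMatrix B :=
  continuous_id.matrix_mul (continuous_id.matrix_map Complex.continuous_conj)

theorem isOpen_setOf_hasDistinctDiagSumForm (n : ℕ) :
    IsOpen {B : Matrix (Fin n) (Fin n) ℂ | HasDistinctDiagSumForm B} := by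
  let p : Matrix (Fin n) (Fin n) ℂ → Polynomial ℂ := fun B => (B * conjMatrix B).charpoly
  have hdeg : ∀ B, (p B).natDegree < n + 1 := fun B => by
    simp [p, Matrix.charpoly_natDegree_eq_dim]
  have hcoeff : ∀ i, Continuous fun B => (p B).coeff i := fun i =>
    (continuous_charpoly_coeff i).comp continuous_mul_conjMatrix
  have hdeg' : ∀ B, (p B).derivative.natDegree < n + 1 := fun B =>
    (Polynomial.natDegree_derivative_le _).trans_lt (by have := hdeg B; omega)
  have hcoeff' : ∀ i, Continuous fun B => (p B).derivative.coeff i := fun i => by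
    simp only [Polynomial.coeff_derivative]
    exact (hcoeff (i + 1)).mul continuous_const
  have hiff : ∀ B : Matrix (Fin n) (Fin n) ℂ, HasDistinctDiagSumForm B ↔ _ := fun B =>
    hasDistinctDiagSumForm_iff.trans (isGenericSpectrum_roots_iff
      (Matrix.charpoly_monic (B * conjMatrix B)).ne_zero (map_charpoly_mul_conjMatrix B) (hdeg B))
  simp only [hiff]
  rw [← Set.compl_ofPred, isOpen_compl_iff]
  refine isClosed_exists_of_bound ?_ (fun B => ∑ i, ∑ j, ‖(B * conjMatrix B) i j‖) ?_ ?_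
  · have h1 : Continuous fun y : Matrix (Fin n) (Fin n) ℂ × ℂ => (p y.1).eval y.2 :=
      continuous_polynomial_eval hdeg hcoeff
    have h2 : Continuous fun y : Matrix (Fin n) (Fin n) ℂ × ℂ => (p y.1).derivative.eval y.2 :=
      continuous_polynomial_eval hdeg' hcoeff'
    have h3 : Continuous fun y : Matrix (Fin n) (Fin n) ℂ × ℂ =>
        dividedDifference (n + 1) (p y.1).derivative y.2 (starRingEnd ℂ y.2) := by
      unfold dividedDifference
      refine continuous_finsetSum _ fun i _ => ((hcoeff' i).comp continuous_fst).mul ?_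
      exact continuous_finsetSum _ fun j _ =>
        (continuous_snd.pow j).mul ((Complex.continuous_conj.comp continuous_snd).pow _)
    refine (isClosed_eq h1 continuous_const).inter
      ((isClosed_eq continuous_snd continuous_const).union
        ((isClosed_eq h2 continuous_const).inter (IsClosed.union ?_
          (isClosed_eq h3 continuous_const))))
    exact (isClosed_eq (Complex.continuous_im.comp continuous_snd) continuous_const).inter
      (isClosed_le continuous_const (Complex.continuous_re.comp continuous_snd))
  · exact continuous_finsetSum _ fun i _ => continuous_finsetSum _ fun j _ =>
      (continuous_mul_conjMatrix.matrix_elem i j).norm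
  · rintro B z ⟨hz, -⟩
    exact norm_le_sum_of_isRoot_charpoly _ hz

/-! ### Density. -/

theorem dense_setOf_isUnit_det (n : ℕ) :
    Dense {B : Matrix (Fin n) (Fin n) ℂ | IsUnit B.det} := by
  intro B
  have hcont : Continuous fun t : ℂ => Matrix.scalar (Fin n) t - (-B) :=
    Continuous.sub (continuous_matrix fun i j => by
      simp only [Matrix.scalar_apply, Matrix.diagonal_apply]
      split_ifs
      · exact continuous_id
      · exact continuous_const) continuous_const
  have h1 : Tendsto (fun t : ℂ => Matrix.scalar (Fin n) t - (-B)) (𝓝[≠] 0) (𝓝 B) := by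
    have h2 := hcont.tendsto 0
    rw [map_zero, zero_sub, neg_neg] at h2
    exact h2.mono_left nhdsWithin_le_nhds
  -- The matrix $B + tI$ is singular only when $t$ is one of the finitely many eigenvalues of $-B$.
  refine mem_closure_of_tendsto h1 (nhdsNE_le_cofinite 0 ?_)
  refine (Finset.finite_toSet (-B).charpoly.roots.toFinset).subset fun t ht => ?_
  simp only [Finset.mem_coe, Multiset.mem_toFinset]
  rw [Polynomial.mem_roots (Matrix.charpoly_monic _).ne_zero, Polynomial.IsRoot.def,
    Matrix.eval_charpoly]
  by_contra hne
  exact ht (isUnit_iff_ne_zero.mpr hne)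

theorem dense_setOf_hasDistinctDiagSumForm (n : ℕ) :
    Dense {B : Matrix (Fin n) (Fin n) ℂ | HasDistinctDiagSumForm B} := by
  -- It suffices that the closure contains the dense set of nonsingular matrices; each of these is a
  -- limit of generic matrices, taken at distances $1/(k+1)$.
  rw [← dense_closure]
  refine (dense_setOf_isUnit_det n).mono fun A hA => ?_
  choose F hF hFgen _ using fun k : ℕ => exists_generic_near A hA (Nat.one_div_pos_of_nat (n := k))
  refine mem_closure_of_tendsto (f := F) (b := atTop) ?_ (Eventually.of_forall hFgen)
  refine tendsto_pi_nhds.mpr fun i => tendsto_pi_nhds.mpr fun j => ?_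
  rw [tendsto_iff_norm_sub_tendsto_zero]
  exact squeeze_zero (fun _ => norm_nonneg _) (fun k => (hF k i j).le)
    (tendsto_one_div_add_atTop_nhds_zero_nat (𝕜 := ℝ))

end

theorem mainTheorem4 (n : ℕ) :
    (∀ A : Matrix (Fin n) (Fin n) ℂ, IsUnit A.det →
      (∃ C : ConsimilarityData, HasCanonicalForm A C) ∧
      ∀ ε : ℝ, 0 < ε →
        ∃ A' : Matrix (Fin n) (Fin n) ℂ,
          (∀ i j, ‖A' i j - A i j‖ < ε) ∧
          HasDistinctDiagSumForm A' ∧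
          ∀ C C' : ConsimilarityData, HasCanonicalForm A C → HasCanonicalForm A' C' →
            C'.numPos = C.numPos ∧ C'.numNeg = C.numNeg ∧ C'.numNonreal = C.numNonreal) ∧
    IsOpen {B : Matrix (Fin n) (Fin n) ℂ | HasDistinctDiagSumForm B} ∧
    Dense {B : Matrix (Fin n) (Fin n) ℂ | HasDistinctDiagSumForm B} :=
  ⟨fun A hA => ⟨exists_hasCanonicalForm A hA, fun _ hε => exists_generic_near A hA hε⟩,
    isOpen_setOf_hasDistinctDiagSumForm n, dense_setOf_hasDistinctDiagSumForm n⟩
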